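/- Two suppliers $i\in\{1,2\}$ (write $-i$ for the other one) compete for a demand $D$. The generation $X_i$ of supplier $i$ takes values in $[0,\bar X_i]$ and has a continuous CDF $F_i$; put $F_i^{-1}(u)=\inf\{x\ge 0: F_i(x)\ge u\}$. Prices lie in $[0,\bar p]$, and the penalty price $\lambda$ satisfies $\lambda>\bar p>0$. Let $\varphi_i=1$ if supplier $i$ has storage and $\varphi_i=0$ otherwise. Supplier $i$ bidding the price $p$ bids the quantity $y_i^*(p)=\mathbb E[X_i]$ if $\varphi_i=1$ and $y_i^*(p)=F_i^{-1}(p/\lambda)$ if $\varphi_i=0$. His revenue from selling a quantity $x$ at price $p$ is $\pi_i^R(p,x)=px-\lambda(x-\mathbb E[X_i])^+$ if $\varphi_i=1$ and $\pi_i^R(p,x)=px-\lambda\,\mathbb E[(x-X_i)^+]$ if $\varphi_i=0$. If $p_i<p_{-i}$, then supplier $i$ sells $\min(D,y_i^*(p_i))$ and supplier $-i$ sells $\min\big(D-\min(D,y_i^*(p_i)),\,y_{-i}^*(p_{-i})\big)$; if $p_1=p_2$, the quantities are those of the order ("$p_1<p_2$" or "$p_2<p_1$") that gives the larger total revenue of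 the two suppliers, and each order is used with probability $1/2$ if the totals agree. A mixed price equilibrium is a pair $(\mu_1,\mu_2)$ of probability measures on $[0,\bar p]$ such that no supplier can increase his expected revenue (prices being drawn independently) by replacing his own $\mu_i$ by another probability measure on $[0,\bar p]$. Let $F_i^e$ be the CDF of $\mu_i$, $l_i=\sup\{p: F_i^e(p)=0\}$ its lower support, and $\pi_i^{RE}$ the expected revenue of supplier $i$ at the equilibrium. **Theorem.** Suppose that exactly one supplier has storage ($\varphi_1+\varphi_2=1$) and $0<D<y_1^*(\bar p)+y_2^*(\bar p)$, and let $(\mu_1,\mu_2)$ be a mixed price equilibrium. Then the lower supports coincide, $l_1=l_2=l$, with $0<l<\bar p$, and for all $p$ with $l\le p<\bar p$: * if $\varphi_i=1$, then $$F_i^e(p)=\frac{\pi_{-i}^R\big(p,\min(y_{-i}^*(p),D)\big)-\pi_{-i}^{RE}}{\pi_{-i}^R\big(p,\min(y_{-i}^*(p),D)\big)-\pi_{-i}^R\big(p,(D-\mathbb E[X_i])^+\big)},$$ where the denominator is positive; * if $\varphi_i=0$, then $$F_i^e(p)=\int_l^{p}\frac{\pi_{-i}^{RE}}{t^2\min(y_i^*(t),D)-t^2\,(D-\mathbb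 E[X_{-i}])^+}\,dt,$$ where the denominator is positive on $[l,\bar p)$ and the integrand is integrable on $[l,p]$. -/

import Mathlib

open MeasureTheory ProbabilityTheory Set

namespace EnergyMarket

/-- One hour of the local energy market with two suppliers, indexed by `Fin 2`.
`gen i` is the law of the random renewable generation of supplier `i`: it is supported in
`[0, Xbar i]` and has a continuous CDF. -/
structure Market where
  /-- unit penalty price for shortfall -/
  lam : ℝ
  /-- cap on the bidding prices -/
  pbar : ℝ
  /-- consumers' (inelastic) demand -/
  D : ℝ
  Xbar : Fin 2 → ℝ
  gen : Fin 2 → Measure ℝ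
  pbar_pos : 0 < pbar
  pbar_lt_lam : pbar < lam
  gen_prob : ∀ i, IsProbabilityMeasure (gen i)
  gen_supp : ∀ i, gen i (Icc 0 (Xbar i))ᶜ = 0
  gen_cont : ∀ i, Continuous (cdf (gen i))

/-- The other supplier, `-i`. -/
def rival (i : Fin 2) : Fin 2 := 1 - i

noncomputable section

namespace Market

variable (M : Market)

/-- Mean generation of supplier `i`. -/
def mean (i : Fin 2) : ℝ := ∫ x, x ∂(M.gen i)

/-- Inverse of the CDF of the generation of supplier `i` (the least `x ≥ 0` with `u ≤ F_i x`; this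
is the inverse function of `F_i` on `[0, Xbar i]` whenever `F_i` is strictly increasing there). -/
def invCDF (i : Fin 2) (u : ℝ) : ℝ := sInf {x : ℝ | 0 ≤ x ∧ u ≤ cdf (M.gen i) x}

/-- The weakly dominant bidding quantity `y_i*(p, s)`, where `s = true` iff supplier `i` has
invested in storage. -/
def qty (i : Fin 2) (s : Bool) (p : ℝ) : ℝ :=
  if s then M.mean i else M.invCDF i (p / M.lam)

/-- Electricity-selling revenue `π_i^R` of supplier `i` at price `p` and committed quantity `x`:
commitment revenue minus (expected) shortfall penalty. -/
def revenue (i : Fin 2) (s : Bool) (p x : ℝ) : ℝ :=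
  p * x - M.lam * (if s then max (x - M.mean i) 0 else ∫ t, max (x - t) 0 ∂(M.gen i))

variable (φ : Fin 2 → Bool)

/-- Revenue of supplier `i` at price `p` if consumers buy from `i` first. -/
def revFirst (i : Fin 2) (p : ℝ) : ℝ :=
  M.revenue i (φ i) p (min M.D (M.qty i (φ i) p))

/-- Revenue of supplier `i` at price `p` if consumers buy first from the rival, who bids `p'`. -/
def revSecond (i : Fin 2) (p p' : ℝ) : ℝ :=
  M.revenue i (φ i) p
    (min (M.D - min M.D (M.qty (rival i) (φ (rival i)) p')) (M.qty i (φ i) p))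

/-- The two suppliers' total revenue if both bid `p` and consumers buy from `i` first. -/
def tieTotal (i : Fin 2) (p : ℝ) : ℝ :=
  M.revFirst φ i p + M.revSecond φ (rival i) p p

/-- Revenue of supplier `i` when he bids the price `p`, his rival bids `p'`, and both bid their
weakly dominant quantities. Consumers buy from the cheaper supplier first; equal prices are
resolved by the order that maximizes the suppliers' total revenue, and by a fair coin if both
orders give the same total. -/
def payoff (i : Fin 2) (p p' : ℝ) : ℝ :=
  if p < p' then M.revFirst φ i p
  else if p' < p then M.revSecond φ i p p'
  else if M.tieTotal φ (rival i) p < M.tieTotal φ i p then M.revFirst φ i p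
  else if M.tieTotal φ i p < M.tieTotal φ (rival i) p then M.revSecond φ i p p'
  else (M.revFirst φ i p + M.revSecond φ i p p') / 2

/-- A mixed price strategy: a probability measure on `[0, pbar]`. -/
def IsPriceStrategy (ν : Measure ℝ) : Prop :=
  IsProbabilityMeasure ν ∧ ν (Icc 0 M.pbar)ᶜ = 0

/-- Expected revenue of supplier `i` who plays `ν` against a rival who plays `ν'`. -/
def expRevenue (i : Fin 2) (ν ν' : Measure ℝ) : ℝ :=
  ∫ z : ℝ × ℝ, M.payoff φ i z.1 z.2 ∂(ν.prod ν')

/-- Mixed price equilibrium. -/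
def IsMixedEquilibrium (μ : Fin 2 → Measure ℝ) : Prop :=
  (∀ i, M.IsPriceStrategy (μ i)) ∧
    ∀ i, ∀ ν : Measure ℝ, M.IsPriceStrategy ν →
      M.expRevenue φ i ν (μ (rival i)) ≤ M.expRevenue φ i (μ i) (μ (rival i))

/-- Revenue `π_i^RE` of supplier `i` at the strategies `μ`. -/
def eqRevenue (μ : Fin 2 → Measure ℝ) (i : Fin 2) : ℝ :=
  M.expRevenue φ i (μ i) (μ (rival i))

end Market

/-- Lower support of a price distribution: `sup {p | F p = 0}`. -/
def lowerSupport (ν : Measure ℝ) : ℝ := sSup {p : ℝ | cdf ν p = 0}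

end

end EnergyMarket

/-! Let `S` have storage and `N` not, and put b = min(D, E[X_S]), a = D − b. When cheaper, `S` earns
p·b; when undercut at a price t he loses g(t) = min(D, y_N(t)) − min(a, y_N(t)) units of sales. `N`
earns G(p) when cheaper and H(p) when dearer, the optimal revenues with sales capped at D and at a;
neither depends on the rival's price. The order matters only above q = λ F_N(a), the price at which
y_N outgrows a. With ν = g·μ_N, a pure price p yields, up to ties, p(b − ν(−∞, p]) to `S` and G(p) −
(G(p) − H(p)) μ_S(−∞, p] to `N`. `UndercuttingEquilibrium` keeps just this, and
`undercuttingEquilibrium` shows that the market is an instance.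

In the abstract game, `N` can secure more than G(q), so he never prices at or near q or below. The
lower supports agree, since below the rival's lower support a higher price loses no sales. A common
atom above q is impossible: at a tie `N` is first with probability at most 1/2, so he would rather
undercut. An atom of one supplier inside (q, P) keeps the other away from the prices just above it,
and then raising the atom into that gap pays. So both payoffs are continuous on (q, P). A stretch of
[l, P) where one supplier is not indifferent again produces a gap across which a price increase
pays, so both are indifferent on all of [l, P) (`UN_eq_piN`, `US_eq_piS`).

The indifference of `N` is linear in F_S and gives the first formula. That of `S` reads ν(−∞, x] = b
− π_S/x, so ν has Lebesgue density π_S/t² above l. Dividing by g > 0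
(`measureReal_Ioc_eq_integral_div`) gives the density of μ_N. -/

namespace EnergyMarket

open Filter Topology

/-! ### Distribution functions of finite measures -/

section FiniteMeasure

variable (ν : Measure ℝ) [IsFiniteMeasure ν]

theorem measureReal_Iic_eq_add (p : ℝ) : ν.real (Iic p) = ν.real (Iio p) + ν.real {p} := by
  rw [← measureReal_union (by simp) (measurableSet_singleton p)]
  congr 1
  ext x; simp [le_iff_lt_or_eq]

variable {ν} in
theorem measureReal_Iic_congr {p q : ℝ} (hpq : p ≤ q) (h : ν (Ioc p q) = 0) :
    ν.real (Iic q) = ν.real (Iic p) := by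
  rw [← Iic_union_Ioc_eq_Iic hpq, measureReal_union (Iic_disjoint_Ioc le_rfl) measurableSet_Ioc,
    measureReal_def ν (Ioc p q), h]
  simp

variable {ν} in
-- Dominated convergence: as `p → x`, the indicators of `Iic p` converge at every point other than
-- `x`, which is null.
theorem continuousAt_measureReal_Iic {x : ℝ} (h : ν {x} = 0) :
    ContinuousAt (fun p => ν.real (Iic p)) x := by
  have key : ContinuousAt (fun p => ∫ t, (Iic p).indicator (fun _ => (1 : ℝ)) t ∂ν) x := by
    refine continuousAt_of_dominated (bound := fun _ => 1) ?_ ?_ (integrable_const _) ?_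
    · exact Eventually.of_forall fun p =>
        (measurable_const.indicator measurableSet_Iic).aestronglyMeasurable
    · refine Eventually.of_forall fun p => Eventually.of_forall fun t => ?_
      by_cases ht : t ∈ Iic p <;> simp [ht]
    · have : ∀ᵐ t ∂ν, t ≠ x := by
        rw [ae_iff]; simpa using h
      filter_upwards [this] with t ht
      rcases lt_or_gt_of_ne ht with ht | ht
      · refine (continuousAt_const (y := (1 : ℝ))).congr ?_
        filter_upwards [lt_mem_nhds ht] with p hp
        simp [hp.le]
      · refine (continuousAt_const (y := (0 : ℝ))).congr ?_
        filter_upwards [gt_mem_nhds ht] with p hp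
        simp [hp]
  simpa [integral_indicator_const _ measurableSet_Iic] using key

end FiniteMeasure

/-! ### Lower supports -/

section LowerSupport

variable {ν : Measure ℝ} {P : ℝ}

theorem measure_Iio_zero (h : ν (Icc 0 P)ᶜ = 0) : ν (Iio 0) = 0 :=
  measure_mono_null (fun x hx => by simp_all) h

variable [IsProbabilityMeasure ν]

theorem measureReal_Iic_eq_one (h : ν (Icc 0 P)ᶜ = 0) : ν.real (Iic P) = 1 := by
  have : ν (Iic P)ᶜ = 0 := measure_mono_null (compl_subset_compl.2 Icc_subset_Iic_self) h
  rw [prob_compl_eq_zero_iff measurableSet_Iic] at this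
  simp [measureReal_def, this]

theorem bddAbove_cdf_eq_zero (h : ν (Icc 0 P)ᶜ = 0) : BddAbove {p : ℝ | cdf ν p = 0} := by
  refine ⟨P, fun p hp => ?_⟩
  by_contra! hlt
  have h1 := monotone_cdf ν hlt.le
  rw [cdf_eq_real, measureReal_Iic_eq_one h, hp] at h1
  linarith

theorem le_lowerSupport (h : ν (Icc 0 P)ᶜ = 0) {p : ℝ} (hp : ν (Iio p) = 0) :
    p ≤ lowerSupport ν := by
  refine le_of_forall_lt fun q hq => ?_
  obtain ⟨r, hqr, hrp⟩ := exists_between hq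
  refine hqr.trans_le (le_csSup (bddAbove_cdf_eq_zero h) ?_)
  have : ν (Iic r) = 0 := measure_mono_null (Iic_subset_Iio.2 hrp) hp
  simp [cdf_eq_real, measureReal_def, this]

theorem lowerSupport_le (h : ν (Icc 0 P)ᶜ = 0) : lowerSupport ν ≤ P := by
  -- Any negative price witnesses that the set is nonempty, because there is no mass below 0.
  refine csSup_le ⟨-1, ?_⟩ fun p hp => ?_
  · have : ν (Iic (-1)) = 0 :=
      measure_mono_null (Iic_subset_Iio.2 (by norm_num)) (measure_Iio_zero h)
    simp [cdf_eq_real, measureReal_def, this]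
  · by_contra! hlt
    have h1 := monotone_cdf ν hlt.le
    rw [cdf_eq_real, measureReal_Iic_eq_one h, hp] at h1
    linarith

theorem measure_Iic_of_lt_lowerSupport (h : ν (Icc 0 P)ᶜ = 0) {p : ℝ} (hp : p < lowerSupport ν) :
    ν (Iic p) = 0 := by
  have hne : {p : ℝ | cdf ν p = 0}.Nonempty := by
    refine ⟨-1, ?_⟩
    have : ν (Iic (-1)) = 0 :=
      measure_mono_null (Iic_subset_Iio.2 (by norm_num)) (measure_Iio_zero h)
    simp [cdf_eq_real, measureReal_def, this]
  obtain ⟨r, hr, hpr⟩ := exists_lt_of_lt_csSup hne hp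
  have h0 : cdf ν r = 0 := hr
  rw [cdf_eq_real, measureReal_eq_zero_iff] at h0
  exact measure_mono_null (Iic_subset_Iic.2 hpr.le) h0

theorem measure_Iio_lowerSupport (h : ν (Icc 0 P)ᶜ = 0) : ν (Iio (lowerSupport ν)) = 0 := by
  obtain ⟨u, -, hu, hlim⟩ := exists_seq_strictMono_tendsto (lowerSupport ν)
  have : Iio (lowerSupport ν) ⊆ ⋃ n, Iic (u n) := by
    intro x hx
    obtain ⟨n, hn⟩ := (hlim.eventually (lt_mem_nhds hx)).exists
    exact mem_iUnion.2 ⟨n, hn.le⟩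
  exact measure_mono_null this
    (measure_iUnion_null fun n => measure_Iic_of_lt_lowerSupport h (hu n))

end LowerSupport

/-! ### Equilibria of the abstract undercutting game -/

/-- A mixed equilibrium of a price game between a supplier `S`, who earns `b` per unit of price
when he is the cheaper one and loses `ν` when undercut, and a supplier `N`, who earns `G` when
cheaper and `H` when dearer. `US` and `UN` are the payoffs from pure prices, which are pinned down
up to ties; the two orders differ only above the price `q`. -/
structure UndercuttingEquilibrium (P b q piS piN : ℝ) (G H US UN : ℝ → ℝ)
    (μS μN ν : Measure ℝ) : Prop where
  probS : IsProbabilityMeasure μS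
  probN : IsProbabilityMeasure μN
  finite_loss : IsFiniteMeasure ν
  suppS : μS (Icc 0 P)ᶜ = 0
  suppN : μN (Icc 0 P)ᶜ = 0
  b_pos : 0 < b
  q_nonneg : 0 ≤ q
  q_lt : q < P
  G_cont : ContinuousOn G (Icc 0 P)
  H_cont : ContinuousOn H (Icc 0 P)
  G_strict : StrictMonoOn G (Icc 0 P)
  G_zero : G 0 = 0
  H_alt : StrictMonoOn H (Icc 0 P) ∨ (q = 0 ∧ ∀ t ∈ Icc 0 P, H t = 0)
  G_eq_H : G q = H q
  H_le_G : ∀ t ∈ Icc 0 P, H t ≤ G t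
  H_lt_G : ∀ t ∈ Ioc q P, H t < G t
  loss_le : ∀ s, ν.real s ≤ b * μN.real s
  loss_zero : ν {0} = 0
  loss_atom : ∀ p ∈ Ioc q P, μN {p} ≠ 0 → ν {p} ≠ 0
  US_lower : ∀ p ∈ Icc 0 P, p * (b - ν.real (Iic p)) ≤ US p
  US_upper : ∀ p ∈ Icc 0 P, US p ≤ p * (b - ν.real (Iio p))
  UN_lower : ∀ p ∈ Icc 0 P, G p - (G p - H p) * μS.real (Iic p) ≤ UN p
  UN_upper : ∀ p ∈ Icc 0 P, UN p ≤ G p - (G p - H p) * (μS.real (Iio p) + μS.real {p} / 2)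
  US_le : ∀ p ∈ Icc 0 P, US p ≤ piS
  UN_le : ∀ p ∈ Icc 0 P, UN p ≤ piN
  US_ae : ∀ᵐ p ∂μS, US p = piS
  UN_ae : ∀ᵐ p ∂μN, UN p = piN

namespace UndercuttingEquilibrium

variable {P b q piS piN : ℝ} {G H US UN : ℝ → ℝ} {μS μN ν : Measure ℝ}

theorem P_pos
    (E : UndercuttingEquilibrium P b q piS piN G H US UN μS μN ν) :
    0 < P := E.q_nonneg.trans_lt E.q_lt

theorem H_mono
    (E : UndercuttingEquilibrium P b q piS piN G H US UN μS μN ν) : MonotoneOn H (Icc 0 P) := by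
  rcases E.H_alt with h | ⟨-, h⟩
  · exact h.monotoneOn
  · intro x hx y hy _
    rw [h x hx, h y hy]

theorem nullS
    (E : UndercuttingEquilibrium P b q piS piN G H US UN μS μN ν)
    {s : Set ℝ} (h : ∀ p ∈ s, p ∈ Icc 0 P → US p < piS) : μS s = 0 := by
  refine measure_mono_null (t := {p | US p = piS}ᶜ ∪ (Icc 0 P)ᶜ) (fun p hp => ?_)
    (measure_union_null E.US_ae E.suppS)
  by_cases hP : p ∈ Icc 0 P
  · exact Or.inl (h p hp hP).ne
  · exact Or.inr hP

theorem nullN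
    (E : UndercuttingEquilibrium P b q piS piN G H US UN μS μN ν)
    {s : Set ℝ} (h : ∀ p ∈ s, p ∈ Icc 0 P → UN p < piN) : μN s = 0 := by
  refine measure_mono_null (t := {p | UN p = piN}ᶜ ∪ (Icc 0 P)ᶜ) (fun p hp => ?_)
    (measure_union_null E.UN_ae E.suppN)
  by_cases hP : p ∈ Icc 0 P
  · exact Or.inl (h p hp hP).ne
  · exact Or.inr hP

theorem US_eq_of_atom
    (E : UndercuttingEquilibrium P b q piS piN G H US UN μS μN ν)
    {p : ℝ} (hp : μS {p} ≠ 0) : US p = piS := by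
  by_contra hne
  refine hp (measure_mono_null (fun x hx => ?_) E.US_ae)
  rw [mem_singleton_iff.1 hx]; exact hne

theorem UN_eq_of_atom
    (E : UndercuttingEquilibrium P b q piS piN G H US UN μS μN ν)
    {p : ℝ} (hp : μN {p} ≠ 0) : UN p = piN := by
  by_contra hne
  refine hp (measure_mono_null (fun x hx => ?_) E.UN_ae)
  rw [mem_singleton_iff.1 hx]; exact hne

theorem loss_null
    (E : UndercuttingEquilibrium P b q piS piN G H US UN μS μN ν)
    {s : Set ℝ} (h : μN s = 0) : ν s = 0 := by
  have := E.finite_loss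
  have h1 := E.loss_le s
  rw [measureReal_def μN, h] at h1
  refine (measureReal_eq_zero_iff (μ := ν)).1 (le_antisymm (by simpa using h1) measureReal_nonneg)

/-- If `N` prices above some r > 0 with positive probability, then `S` earns a positive amount at r.
Otherwise `N` prices at 0, where he takes no sales away, and `S` earns P·b at the cap. -/
theorem piS_pos
    (E : UndercuttingEquilibrium P b q piS piN G H US UN μS μN ν) : 0 < piS := by
  have := E.finite_loss
  have := E.probN
  by_cases h : μN (Ioi 0) = 0
  · have h0 : ν univ = 0 := by
      have : (univ : Set ℝ) = Iio 0 ∪ {0} ∪ Ioi 0 := by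
        ext x; simp
      rw [this]
      exact measure_union_null (measure_union_null (E.loss_null (measure_Iio_zero E.suppN))
        E.loss_zero) (E.loss_null h)
    have h1 : ν.real (Iic P) = 0 := by
      rw [measureReal_eq_zero_iff]; exact measure_mono_null (subset_univ _) h0
    have h2 := E.US_lower P ⟨E.P_pos.le, le_rfl⟩
    have h3 := E.US_le P ⟨E.P_pos.le, le_rfl⟩
    rw [h1, sub_zero] at h2
    exact (mul_pos E.P_pos E.b_pos).trans_le (h2.trans h3)
  · obtain ⟨r, hr0, hr⟩ : ∃ r : ℝ, 0 < r ∧ μN (Ioi r) ≠ 0 := by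
      by_contra! hall
      obtain ⟨u, -, hu, hlim⟩ := exists_seq_strictAnti_tendsto (0 : ℝ)
      refine h (measure_mono_null (t := ⋃ n, Ioi (u n)) (fun x hx => ?_)
        (measure_iUnion_null fun n => hall _ (hu n)))
      obtain ⟨n, hn⟩ := (hlim.eventually (gt_mem_nhds hx)).exists
      exact mem_iUnion.2 ⟨n, hn⟩
    have hrP : r < P := by
      by_contra! hle
      exact hr (measure_mono_null (fun x hx => by
        simp only [mem_compl_iff, mem_Icc, not_and, not_le]
        exact fun _ => hle.trans_lt hx) E.suppN)
    have h1 : μN.real (Iic r) < 1 := by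
      have h2 := probReal_compl_eq_one_sub (μ := μN) (measurableSet_Iic (a := r))
      have h3 : 0 < μN.real (Iic r)ᶜ := by
        rw [compl_Iic]
        exact measureReal_nonneg.lt_of_ne' (fun h0 => hr ((measureReal_eq_zero_iff).1 h0))
      linarith
    have hmem : r ∈ Icc 0 P := ⟨hr0.le, hrP.le⟩
    have h2 : ν.real (Iic r) < b :=
      (E.loss_le _).trans_lt (by nlinarith [E.b_pos])
    exact (mul_pos hr0 (sub_pos.2 h2)).trans_le ((E.US_lower r hmem).trans (E.US_le r hmem))

theorem US_le_mul
    (E : UndercuttingEquilibrium P b q piS piN G H US UN μS μN ν)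
    {p : ℝ} (hp : p ∈ Icc 0 P) : US p ≤ p * b :=
  (E.US_upper p hp).trans (mul_le_mul_of_nonneg_left (sub_le_self _ measureReal_nonneg) hp.1)

theorem UN_le_G
    (E : UndercuttingEquilibrium P b q piS piN G H US UN μS μN ν)
    {p : ℝ} (hp : p ∈ Icc 0 P) : UN p ≤ G p := by
  refine (E.UN_upper p hp).trans (sub_le_self _ (mul_nonneg (sub_nonneg.2 (E.H_le_G p hp)) ?_))
  positivity

theorem UN_upper'
    (E : UndercuttingEquilibrium P b q piS piN G H US UN μS μN ν)
    {p : ℝ} (hp : p ∈ Icc 0 P) : UN p ≤ G p - (G p - H p) * μS.real (Iio p) := by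
  refine (E.UN_upper p hp).trans (sub_le_sub_left (mul_le_mul_of_nonneg_left ?_
    (sub_nonneg.2 (E.H_le_G p hp))) _)
  linarith [measureReal_nonneg (μ := μS) (s := {p})]

/-- Below `piS / b`, even selling b for certain earns less than `piS`. -/
theorem measureS_Iio
    (E : UndercuttingEquilibrium P b q piS piN G H US UN μS μN ν) : μS (Iio (piS / b)) = 0 := by
  refine E.nullS fun p hp hP => (E.US_le_mul hP).trans_lt ?_
  exact (lt_div_iff₀ E.b_pos).1 hp

/-- If H is strictly increasing, the price P secures H(P) > H(q) = G(q). Otherwise q = 0 and G(q) =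
0, and any small positive price below `piS / b` is certain to be the cheaper one. -/
theorem G_threshold_lt_piN
    (E : UndercuttingEquilibrium P b q piS piN G H US UN μS μN ν) : G q < piN := by
  have := E.probS
  have := E.probN
  rcases E.H_alt with h | ⟨h, -⟩
  · have hPm : P ∈ Icc 0 P := ⟨E.P_pos.le, le_rfl⟩
    have h1 := h ⟨E.q_nonneg, E.q_lt.le⟩ hPm E.q_lt
    have h2 := (E.UN_lower P hPm).trans (E.UN_le P hPm)
    rw [measureReal_Iic_eq_one E.suppS] at h2
    rw [E.G_eq_H]
    linarith
  · have hpos : 0 < piS / b := div_pos E.piS_pos E.b_pos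
    obtain ⟨r, hr0, hr⟩ := exists_between (lt_min hpos E.P_pos)
    have hrm : r ∈ Icc 0 P := ⟨hr0.le, (hr.trans_le (min_le_right _ _)).le⟩
    have h0 : μS (Iic r) = 0 :=
      measure_mono_null (Iic_subset_Iio.2 (hr.trans_le (min_le_left _ _))) E.measureS_Iio
    have h1 := (E.UN_lower r hrm).trans (E.UN_le r hrm)
    rw [measureReal_def, h0] at h1
    have h2 := E.G_strict ⟨le_rfl, E.P_pos.le⟩ hrm hr0
    rw [h]
    simp at h1
    linarith

theorem piN_pos
    (E : UndercuttingEquilibrium P b q piS piN G H US UN μS μN ν) : 0 < piN := by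
  have h := E.G_strict.monotoneOn ⟨le_rfl, E.P_pos.le⟩ ⟨E.q_nonneg, E.q_lt.le⟩ E.q_nonneg
  rw [E.G_zero] at h
  exact h.trans_lt E.G_threshold_lt_piN

theorem lt_lowerSupportN
    (E : UndercuttingEquilibrium P b q piS piN G H US UN μS μN ν) : q < lowerSupport μN := by
  have := E.probN
  have hc := E.G_cont q ⟨E.q_nonneg, E.q_lt.le⟩
  have hc' : ContinuousWithinAt G (Ioo q P) q :=
    hc.mono fun x hx => ⟨E.q_nonneg.trans hx.1.le, hx.2.le⟩
  have hev : ∀ᶠ x in 𝓝[>] q, x ∈ Ioo q P ∧ G x < piN := by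
    rw [← nhdsWithin_Ioo_eq_nhdsGT E.q_lt]
    exact eventually_mem_nhdsWithin.and (hc'.eventually (gt_mem_nhds E.G_threshold_lt_piN))
  obtain ⟨r, hr, hG⟩ := hev.exists
  refine hr.1.trans_le (le_lowerSupport E.suppN (E.nullN fun p hp hP => ?_))
  exact (E.UN_le_G hP).trans_lt
    ((E.G_strict hP ⟨E.q_nonneg.trans hr.1.le, hr.2.le⟩ hp).trans hG)

/-- Below the rival's lower support a supplier is cheaper for certain, so a slightly higher price is
strictly better and he puts no mass there. -/
theorem lowerSupport_eq
    (E : UndercuttingEquilibrium P b q piS piN G H US UN μS μN ν) :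
    lowerSupport μS = lowerSupport μN := by
  have := E.probN
  have := E.probS
  have := E.finite_loss
  refine le_antisymm ?_ ?_
  · refine le_lowerSupport E.suppN (E.nullN fun p hp hP => ?_)
    obtain ⟨r, hpr, hr⟩ := exists_between (mem_Iio.1 hp)
    have hrm : r ∈ Icc 0 P := ⟨hP.1.trans hpr.le, hr.le.trans (lowerSupport_le E.suppS)⟩
    have h0 := measure_Iic_of_lt_lowerSupport E.suppS hr
    have h1 := (E.UN_lower r hrm).trans (E.UN_le r hrm)
    rw [measureReal_def, h0] at h1
    have h2 := E.G_strict hP hrm hpr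
    have h3 := E.UN_le_G hP
    simp at h1
    linarith
  · refine le_lowerSupport E.suppS (E.nullS fun p hp hP => ?_)
    obtain ⟨r, hpr, hr⟩ := exists_between (mem_Iio.1 hp)
    have hrm : r ∈ Icc 0 P := ⟨hP.1.trans hpr.le, hr.le.trans (lowerSupport_le E.suppN)⟩
    have h0 := E.loss_null (measure_Iic_of_lt_lowerSupport E.suppN hr)
    have h1 := (E.US_lower r hrm).trans (E.US_le r hrm)
    rw [measureReal_def, h0] at h1
    have h2 := mul_lt_mul_of_pos_right hpr E.b_pos
    have h3 := E.US_le_mul hP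
    simp at h1
    linarith

/-- Prices tending to p from below lose only to rivals strictly below p, so an atom of `S` at p
costs nothing in the limit. -/
theorem G_sub_le_piN
    (E : UndercuttingEquilibrium P b q piS piN G H US UN μS μN ν) {p : ℝ} (hp : p ∈ Ioc 0 P) :
    G p - (G p - H p) * μS.real (Iio p) ≤ piN := by
  have := E.probS
  have hsub : Ioo 0 p ⊆ Icc 0 P := fun x hx => ⟨hx.1.le, hx.2.le.trans hp.2⟩
  have hG := (E.G_cont p ⟨hp.1.le, hp.2⟩).mono hsub
  have hH := (E.H_cont p ⟨hp.1.le, hp.2⟩).mono hsub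
  have ht : Tendsto (fun r => G r - (G r - H r) * μS.real (Iio p)) (𝓝[Ioo 0 p] p)
      (𝓝 (G p - (G p - H p) * μS.real (Iio p))) :=
    Tendsto.sub hG (Tendsto.mul_const _ (Tendsto.sub hG hH))
  have : (𝓝[Ioo 0 p] p).NeBot := by
    rw [nhdsWithin_Ioo_eq_nhdsLT hp.1]; infer_instance
  refine le_of_tendsto ht ?_
  filter_upwards [self_mem_nhdsWithin] with r hr
  have hrm := hsub hr
  refine le_trans ?_ ((E.UN_lower r hrm).trans (E.UN_le r hrm))
  refine sub_le_sub_left (mul_le_mul_of_nonneg_left ?_ (sub_nonneg.2 (E.H_le_G r hrm))) _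
  exact measureReal_mono (Iic_subset_Iio.2 hr.2)

theorem mul_sub_le_piS
    (E : UndercuttingEquilibrium P b q piS piN G H US UN μS μN ν)
    {p : ℝ} (hp : p ∈ Ioc 0 P) : p * (b - ν.real (Iio p)) ≤ piS := by
  have := E.finite_loss
  have ht : Tendsto (fun r => r * (b - ν.real (Iio p))) (𝓝[Ioo 0 p] p)
      (𝓝 (p * (b - ν.real (Iio p)))) := (tendsto_id.mono_left nhdsWithin_le_nhds).mul_const _
  have : (𝓝[Ioo 0 p] p).NeBot := by
    rw [nhdsWithin_Ioo_eq_nhdsLT hp.1]; infer_instance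
  refine le_of_tendsto ht ?_
  filter_upwards [self_mem_nhdsWithin] with r hr
  have hrm : r ∈ Icc 0 P := ⟨hr.1.le, hr.2.le.trans hp.2⟩
  refine le_trans ?_ ((E.US_lower r hrm).trans (E.US_le r hrm))
  exact mul_le_mul_of_nonneg_left
    (sub_le_sub_left (measureReal_mono (Iic_subset_Iio.2 hr.2)) _) hr.1.le

/-- Approaching p from below avoids the tie, which costs `N` at least half of (G − H)·μ_S{p}. The
endpoint P is included, as `lowerSupport_lt` requires. -/
theorem no_common_atom
    (E : UndercuttingEquilibrium P b q piS piN G H US UN μS μN ν)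
    {p : ℝ} (hp : p ∈ Ioc q P) (hN : μN {p} ≠ 0) : μS {p} = 0 := by
  have := E.probS
  by_contra hS
  have hp0 : p ∈ Ioc 0 P := ⟨E.q_nonneg.trans_lt hp.1, hp.2⟩
  have h1 := E.G_sub_le_piN hp0
  have h2 := E.UN_upper p ⟨hp0.1.le, hp0.2⟩
  rw [E.UN_eq_of_atom hN] at h2
  have h3 : 0 < μS.real {p} :=
    measureReal_nonneg.lt_of_ne' fun h0 => hS ((measureReal_eq_zero_iff).1 h0)
  have h4 := mul_pos (sub_pos.2 (E.H_lt_G p hp)) h3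
  linarith

/-- The mixture (1 − c)G + cH is strictly increasing unless c = 1 and H vanishes, and in that case
it cannot reach `piN > 0`. -/
theorem false_of_mix
    (E : UndercuttingEquilibrium P b q piS piN G H US UN μS μN ν)
    {p r c : ℝ} (hp : 0 ≤ p) (hpr : p < r) (hr : r ≤ P) (hc0 : 0 ≤ c)
    (hc1 : c ≤ 1) (h1 : piN ≤ G p - (G p - H p) * c) (h2 : G r - (G r - H r) * c ≤ piN) :
    False := by
  have hpm : p ∈ Icc 0 P := ⟨hp, hpr.le.trans hr⟩
  have hrm : r ∈ Icc 0 P := ⟨hp.trans hpr.le, hr⟩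
  have hG := E.G_strict hpm hrm hpr
  have hH := E.H_mono hpm hrm hpr.le
  rcases hc1.lt_or_eq with hc | rfl
  · nlinarith
  · rcases E.H_alt with h | ⟨-, h⟩
    · have := h hpm hrm hpr
      linarith
    · have := h p hpm
      linarith [E.piN_pos]

/-- Passing an atom of `N` costs `S` a jump in sales, so a price just above p is worse than one just
below. -/
theorem eventually_US_lt
    (E : UndercuttingEquilibrium P b q piS piN G H US UN μS μN ν)
    {p : ℝ} (hp : p ∈ Ioo q P) (hN : μN {p} ≠ 0) :
    ∃ r ∈ Ioo p P, ∀ x ∈ Ioo p r, US x < piS := by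
  have := E.finite_loss
  have hp0 : 0 < p := E.q_nonneg.trans_lt hp.1
  have h1 := E.mul_sub_le_piS ⟨hp0, hp.2.le⟩
  have h3 : 0 < ν.real {p} := measureReal_nonneg.lt_of_ne' fun h0 =>
    E.loss_atom p ⟨hp.1, hp.2.le⟩ hN ((measureReal_eq_zero_iff).1 h0)
  have h4 := measureReal_Iic_eq_add ν p
  have h5 : p * (b - ν.real (Iic p)) < piS := by
    refine lt_of_lt_of_le (mul_lt_mul_of_pos_left ?_ hp0) h1
    linarith
  have ht : Tendsto (fun x => x * (b - ν.real (Iic p))) (𝓝[>] p)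
      (𝓝 (p * (b - ν.real (Iic p)))) := (tendsto_id.mono_left nhdsWithin_le_nhds).mul_const _
  obtain ⟨r, hr, hrs⟩ := (mem_nhdsGT_iff_exists_Ioo_subset' hp.2).1
    (ht.eventually (gt_mem_nhds h5))
  obtain ⟨r', hr', hr''⟩ := exists_between (lt_min (mem_Ioi.1 hr) hp.2)
  refine ⟨r', ⟨hr', hr''.trans_le (min_le_right _ _)⟩, fun x hx => ?_⟩
  have hxr : x ∈ Ioo p r := ⟨hx.1, hx.2.trans (hr''.trans_le (min_le_left _ _))⟩
  have hxP : x ∈ Icc 0 P :=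
    ⟨hp0.le.trans hx.1.le, (hx.2.trans (hr''.trans_le (min_le_right _ _))).le⟩
  refine (E.US_upper x hxP).trans_lt (lt_of_le_of_lt ?_ (hrs hxr))
  exact mul_le_mul_of_nonneg_left
    (sub_le_sub_left (measureReal_mono (Iic_subset_Iio.2 hx.1)) _) hxP.1

theorem eventually_UN_lt
    (E : UndercuttingEquilibrium P b q piS piN G H US UN μS μN ν)
    {p : ℝ} (hp : p ∈ Ioo q P) (hS : μS {p} ≠ 0) :
    ∃ r ∈ Ioo p P, ∀ x ∈ Ioo p r, UN x < piN := by
  have := E.probS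
  have hp0 : 0 < p := E.q_nonneg.trans_lt hp.1
  have h1 := E.G_sub_le_piN ⟨hp0, hp.2.le⟩
  have h3 : 0 < μS.real {p} :=
    measureReal_nonneg.lt_of_ne' fun h0 => hS ((measureReal_eq_zero_iff).1 h0)
  have h4 := measureReal_Iic_eq_add μS p
  have h5 : G p - (G p - H p) * μS.real (Iic p) < piN := by
    have := mul_pos (sub_pos.2 (E.H_lt_G p ⟨hp.1, hp.2.le⟩)) h3
    rw [h4]; linarith
  have hsub : Ioo p P ⊆ Icc 0 P := fun x hx => ⟨hp0.le.trans hx.1.le, hx.2.le⟩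
  have hG := (E.G_cont p ⟨hp0.le, hp.2.le⟩).mono hsub
  have hH := (E.H_cont p ⟨hp0.le, hp.2.le⟩).mono hsub
  have ht : Tendsto (fun x => G x - (G x - H x) * μS.real (Iic p)) (𝓝[Ioo p P] p)
      (𝓝 (G p - (G p - H p) * μS.real (Iic p))) :=
    Tendsto.sub hG (Tendsto.mul_const _ (Tendsto.sub hG hH))
  rw [nhdsWithin_Ioo_eq_nhdsGT hp.2] at ht
  obtain ⟨r, hr, hrs⟩ := (mem_nhdsGT_iff_exists_Ioo_subset' hp.2).1
    (ht.eventually (gt_mem_nhds h5))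
  obtain ⟨r', hr', hr''⟩ := exists_between (lt_min (mem_Ioi.1 hr) hp.2)
  refine ⟨r', ⟨hr', hr''.trans_le (min_le_right _ _)⟩, fun x hx => ?_⟩
  have hxr : x ∈ Ioo p r := ⟨hx.1, hx.2.trans (hr''.trans_le (min_le_left _ _))⟩
  have hxP : x ∈ Icc 0 P :=
    ⟨hp0.le.trans hx.1.le, (hx.2.trans (hr''.trans_le (min_le_right _ _))).le⟩
  refine (E.UN_upper' hxP).trans_lt (lt_of_le_of_lt ?_ (hrs hxr))
  refine sub_le_sub_left (mul_le_mul_of_nonneg_left ?_ (sub_nonneg.2 (E.H_le_G x hxP))) _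
  exact measureReal_mono (Iic_subset_Iio.2 hx.1)

/-- `S` avoids both the atom and the prices just above it, so `N` could move the atom up through the
gap and meet no more competition. -/
theorem no_atomN
    (E : UndercuttingEquilibrium P b q piS piN G H US UN μS μN ν)
    {p : ℝ} (hp : p ∈ Ioo q P) : μN {p} = 0 := by
  have := E.probS
  by_contra hN
  have hp0 : 0 < p := E.q_nonneg.trans_lt hp.1
  have hS := E.no_common_atom ⟨hp.1, hp.2.le⟩ hN
  obtain ⟨r, hr, hlt⟩ := E.eventually_US_lt hp hN
  obtain ⟨x, hpx, hxr⟩ := exists_between hr.1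
  have h0 : μS (Ioc p x) = 0 :=
    E.nullS fun y hy _ => hlt y ⟨hy.1, hy.2.trans_lt hxr⟩
  have h1 := measureReal_Iic_congr hpx.le h0
  have h2 := measureReal_Iic_eq_add μS p
  rw [measureReal_def μS {p}, hS] at h2
  simp only [ENNReal.toReal_zero, add_zero] at h2
  have h3 := E.UN_upper' ⟨hp0.le, hp.2.le⟩
  rw [E.UN_eq_of_atom hN] at h3
  have hxm : x ∈ Icc 0 P := ⟨hp0.le.trans hpx.le, (hxr.trans hr.2).le⟩
  have h4 := (E.UN_lower x hxm).trans (E.UN_le x hxm)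
  rw [h1, h2] at h4
  exact E.false_of_mix hp0.le hpx hxm.2 measureReal_nonneg measureReal_le_one h3 h4

/-- `N` avoids the prices just above the atom and has no atom there himself. Raising the price in
that gap therefore leaves the sales of `S`, which are positive, unchanged. -/
theorem no_atomS
    (E : UndercuttingEquilibrium P b q piS piN G H US UN μS μN ν)
    {p : ℝ} (hp : p ∈ Ioo q P) : μS {p} = 0 := by
  have := E.finite_loss
  by_contra hS
  have hp0 : 0 < p := E.q_nonneg.trans_lt hp.1
  obtain ⟨r, hr, hlt⟩ := E.eventually_UN_lt hp hS
  obtain ⟨x, hpx, hxr⟩ := exists_between hr.1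
  have h0 : ν (Ioc p x) = 0 :=
    E.loss_null (E.nullN fun y hy _ => hlt y ⟨hy.1, hy.2.trans_lt hxr⟩)
  have h1 := measureReal_Iic_congr hpx.le h0
  have h2 := measureReal_Iic_eq_add ν p
  rw [measureReal_def ν {p}, E.loss_null (E.no_atomN hp)] at h2
  simp only [ENNReal.toReal_zero, add_zero] at h2
  have h3 := E.US_upper p ⟨hp0.le, hp.2.le⟩
  rw [E.US_eq_of_atom hS] at h3
  have hxm : x ∈ Icc 0 P := ⟨hp0.le.trans hpx.le, (hxr.trans hr.2).le⟩
  have h4 := (E.US_lower x hxm).trans (E.US_le x hxm)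
  rw [h1, h2] at h4
  have h5 : 0 < b - ν.real (Iio p) := pos_of_mul_pos_right (E.piS_pos.trans_le h3) hp0.le
  have := mul_lt_mul_of_pos_right hpx h5
  linarith

/-- Otherwise both suppliers would have all their mass at P, a common atom. -/
theorem lowerSupport_lt
    (E : UndercuttingEquilibrium P b q piS piN G H US UN μS μN ν) : lowerSupport μN < P := by
  have := E.probS
  have := E.probN
  refine (lowerSupport_le E.suppN).lt_of_ne fun heq => ?_
  have aux : ∀ (μ : Measure ℝ) [IsProbabilityMeasure μ], μ (Icc 0 P)ᶜ = 0 →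
      lowerSupport μ = P → μ {P} ≠ 0 := by
    intro μ _ hsupp hl h0
    have h1 := measureReal_Iic_eq_add μ P
    have h2 := measure_Iio_lowerSupport hsupp
    rw [hl] at h2
    rw [measureReal_Iic_eq_one hsupp, measureReal_def, measureReal_def, h0, h2] at h1
    simp at h1
  exact aux μS E.suppS (E.lowerSupport_eq.trans heq)
    (E.no_common_atom ⟨E.q_lt, le_rfl⟩ (aux μN E.suppN heq))

theorem UN_eq
    (E : UndercuttingEquilibrium P b q piS piN G H US UN μS μN ν)
    {p : ℝ} (hp : p ∈ Ioo q P) : UN p = G p - (G p - H p) * μS.real (Iic p) := by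
  have := E.probS
  have hm : p ∈ Icc 0 P := ⟨E.q_nonneg.trans hp.1.le, hp.2.le⟩
  refine le_antisymm ?_ (E.UN_lower p hm)
  have h2 := measureReal_Iic_eq_add μS p
  rw [measureReal_def μS {p}, E.no_atomS hp] at h2
  simp only [ENNReal.toReal_zero, add_zero] at h2
  rw [h2]
  exact E.UN_upper' hm

theorem US_eq
    (E : UndercuttingEquilibrium P b q piS piN G H US UN μS μN ν)
    {p : ℝ} (hp : p ∈ Ioo q P) : US p = p * (b - ν.real (Iic p)) := by
  have := E.finite_loss
  have hm : p ∈ Icc 0 P := ⟨E.q_nonneg.trans hp.1.le, hp.2.le⟩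
  refine le_antisymm ?_ (E.US_lower p hm)
  have h2 := measureReal_Iic_eq_add ν p
  rw [measureReal_def ν {p}, E.loss_null (E.no_atomN hp)] at h2
  simp only [ENNReal.toReal_zero, add_zero] at h2
  rw [h2]
  exact E.US_upper p hm

theorem UN_continuousAt
    (E : UndercuttingEquilibrium P b q piS piN G H US UN μS μN ν)
    {p : ℝ} (hp : p ∈ Ioo q P) : ContinuousAt UN p := by
  have := E.probS
  have hnhds : Icc 0 P ∈ 𝓝 p := Icc_mem_nhds (E.q_nonneg.trans_lt hp.1) hp.2
  have hG := E.G_cont.continuousAt hnhds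
  have hH := E.H_cont.continuousAt hnhds
  have hA := continuousAt_measureReal_Iic (E.no_atomS hp)
  refine (hG.sub ((hG.sub hH).mul hA)).congr ?_
  filter_upwards [Ioo_mem_nhds hp.1 hp.2] with x hx using (E.UN_eq hx).symm

theorem US_continuousAt
    (E : UndercuttingEquilibrium P b q piS piN G H US UN μS μN ν)
    {p : ℝ} (hp : p ∈ Ioo q P) : ContinuousAt US p := by
  have := E.finite_loss
  have hA := continuousAt_measureReal_Iic (E.loss_null (E.no_atomN hp))
  refine (continuousAt_id.mul ((continuousAt_const (y := b)).sub hA)).congr ?_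
  filter_upwards [Ioo_mem_nhds hp.1 hp.2] with x hx using (E.US_eq hx).symm

/-- A price where `N` is not indifferent ends a gap of μ_N. The sales of `S` are constant over this
gap, so `S` prefers its upper end and leaves the lower part empty. `N` then gains by raising his
price from the bottom of the gap. -/
theorem UN_eq_piN
    (E : UndercuttingEquilibrium P b q piS piN G H US UN μS μN ν)
    {p : ℝ} (hp : p ∈ Ico (lowerSupport μN) P) : UN p = piN := by
  have := E.probS
  have := E.probN
  have := E.finite_loss
  set l := lowerSupport μN with hl
  have hql : q < l := E.lt_lowerSupportN
  have hsub : ∀ {x}, x ∈ Ico l P → x ∈ Ioo q P := fun hx => ⟨hql.trans_le hx.1, hx.2⟩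
  have hsub' : ∀ {x}, x ∈ Ioo q P → x ∈ Icc 0 P := fun hx =>
    ⟨E.q_nonneg.trans hx.1.le, hx.2.le⟩
  have hlm : l ∈ Ico l P := ⟨le_rfl, E.lowerSupport_lt⟩
  have hUl : UN l = piN := by
    by_contra hne
    have hlt : UN l < piN := (E.UN_le l (hsub' (hsub hlm))).lt_of_ne hne
    obtain ⟨u, hu, hus⟩ := exists_Ico_subset_of_mem_nhds
      ((E.UN_continuousAt (hsub hlm)).eventually (gt_mem_nhds hlt)) ⟨P, hlm.2⟩
    have h0 : μN (Ico l u) = 0 := E.nullN fun x hx _ => hus hx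
    have h1 : μN (Iio u) = 0 := by
      rw [← Iio_union_Ico_eq_Iio hu.le]
      exact measure_union_null (measure_Iio_lowerSupport E.suppN) h0
    exact absurd (le_lowerSupport E.suppN h1) (not_le.2 hu)
  by_contra hne
  have hcont : ContinuousOn UN (Icc l p) := fun x hx =>
    (E.UN_continuousAt (hsub ⟨hx.1, hx.2.trans_lt hp.2⟩)).continuousWithinAt
  -- Compactness provides the last price c ≤ p at which `N` is indifferent.
  have hcomp : IsCompact (Icc l p ∩ UN ⁻¹' {piN}) :=
    isCompact_Icc.of_isClosed_subset
      (hcont.preimage_isClosed_of_isClosed isClosed_Icc isClosed_singleton) inter_subset_left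
  obtain ⟨c, ⟨hcm, hc⟩, hcmax⟩ := hcomp.exists_isGreatest ⟨l, ⟨le_rfl, hp.1⟩, hUl⟩
  have hc : UN c = piN := hc
  have hcp : c < p := hcm.2.lt_of_ne fun h => hne (h ▸ hc)
  have hmem : ∀ {x}, x ∈ Icc c p → x ∈ Ioo q P := fun hx =>
    hsub ⟨hcm.1.trans hx.1, hx.2.trans_lt hp.2⟩
  have hN0 : μN (Ioc c p) = 0 := E.nullN fun x hx hxm => by
    refine (E.UN_le x hxm).lt_of_ne fun h => ?_
    exact absurd (hcmax ⟨⟨hcm.1.trans hx.1.le, hx.2⟩, h⟩) (not_le.2 hx.1)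
  have hν : ∀ x ∈ Icc c p, ν.real (Iic x) = ν.real (Iic c) := fun x hx =>
    measureReal_Iic_congr hx.1
      (E.loss_null (measure_mono_null (Ioc_subset_Ioc_right hx.2) hN0))
  obtain ⟨r, hcr, hrp⟩ := exists_between hcp
  have hS0 : μS (Ioc c r) = 0 := E.nullS fun x hx _ => by
    have hxm : x ∈ Icc c p := ⟨hx.1.le, hx.2.trans hrp.le⟩
    have hpm : p ∈ Icc c p := ⟨hcp.le, le_rfl⟩
    have h1 := E.US_le p (hsub' (hmem hpm))
    rw [E.US_eq (hmem hpm), hν p hpm] at h1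
    rw [E.US_eq (hmem hxm), hν x hxm]
    have hx0 : 0 ≤ x := (hsub' (hmem hxm)).1
    -- On the gap the payoff of `S` is linear in the price. With slope ≤ 0 it stays below `piS > 0`;
    -- with positive slope it is beaten by the price p.
    rcases le_or_gt (b - ν.real (Iic c)) 0 with h | h
    · exact (mul_nonpos_of_nonneg_of_nonpos hx0 h).trans_lt E.piS_pos
    · exact (mul_lt_mul_of_pos_right (hx.2.trans_lt hrp) h).trans_le h1
  have hcm' := hmem ⟨le_rfl, hcp.le⟩
  have hrm' := hmem ⟨hcr.le, hrp.le⟩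
  have h1 := E.UN_le r (hsub' hrm')
  rw [E.UN_eq hrm', measureReal_Iic_congr hcr.le hS0] at h1
  rw [E.UN_eq hcm'] at hc
  exact E.false_of_mix (hsub' hcm').1 hcr hrm'.2.le measureReal_nonneg measureReal_le_one hc.ge h1

/-- A strict loss of `S` at p persists to the right and empties μ_S there. By `UN_eq_piN` the payoff
of `N` would still be constant there, contradicting `false_of_mix`. -/
theorem US_eq_piS
    (E : UndercuttingEquilibrium P b q piS piN G H US UN μS μN ν)
    {p : ℝ} (hp : p ∈ Ico (lowerSupport μN) P) : US p = piS := by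
  have := E.probS
  have hsub : ∀ {x}, x ∈ Ico (lowerSupport μN) P → x ∈ Ioo q P := fun hx =>
    ⟨E.lt_lowerSupportN.trans_le hx.1, hx.2⟩
  have hp0 : 0 ≤ p := E.q_nonneg.trans (hsub hp).1.le
  by_contra hne
  have hlt : US p < piS := (E.US_le p ⟨hp0, hp.2.le⟩).lt_of_ne hne
  obtain ⟨u, hu, hus⟩ := exists_Ico_subset_of_mem_nhds
    ((E.US_continuousAt (hsub hp)).eventually (gt_mem_nhds hlt)) ⟨P, hp.2⟩
  obtain ⟨r, hpr, hr⟩ := exists_between (lt_min hu hp.2)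
  have hS0 : μS (Ioc p r) = 0 := E.nullS fun x hx _ =>
    hus ⟨hx.1.le, hx.2.trans_lt (hr.trans_le (min_le_left _ _))⟩
  have hrm : r ∈ Ico (lowerSupport μN) P := ⟨hp.1.trans hpr.le, hr.trans_le (min_le_right _ _)⟩
  have h1 := E.UN_eq_piN hp
  have h2 := E.UN_eq_piN hrm
  rw [E.UN_eq (hsub hp)] at h1
  rw [E.UN_eq (hsub hrm), measureReal_Iic_congr hpr.le hS0] at h2
  exact E.false_of_mix hp0 hpr hrm.2.le measureReal_nonneg measureReal_le_one h1.ge h2.le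

end UndercuttingEquilibrium

end EnergyMarket

/-! ### Generation, quantiles and the capped revenue of a supplier without storage -/

namespace EnergyMarket

namespace Market

open Filter Topology

variable (M : Market) (i : Fin 2)

theorem lam_pos : 0 < M.lam := M.pbar_pos.trans M.pbar_lt_lam

theorem gen_ae_mem : ∀ᵐ t ∂(M.gen i), t ∈ Icc 0 (M.Xbar i) := M.gen_supp i

theorem integrable_gen_id : Integrable (fun t : ℝ => t) (M.gen i) := by
  have := M.gen_prob i
  refine Integrable.of_bound measurable_id.aestronglyMeasurable (M.Xbar i) ?_
  filter_upwards [M.gen_ae_mem i] with t ht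
  rw [Real.norm_eq_abs, abs_of_nonneg ht.1]
  exact ht.2

theorem cdf_gen_zero : cdf (M.gen i) 0 = 0 := by
  have := M.gen_prob i
  have h : ∀ x < 0, cdf (M.gen i) x = 0 := fun x hx => by
    rw [cdf_eq_real, measureReal_eq_zero_iff]
    exact measure_mono_null (t := (Icc 0 (M.Xbar i))ᶜ)
      (fun t ht h0 => absurd (h0.1.trans ht) (not_le.2 hx)) (M.gen_supp i)
  have ht : Tendsto (cdf (M.gen i)) (𝓝[<] 0) (𝓝 (cdf (M.gen i) 0)) :=
    ((M.gen_cont i).tendsto 0).mono_left nhdsWithin_le_nhds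
  refine tendsto_nhds_unique ht (tendsto_const_nhds.congr' ?_)
  filter_upwards [self_mem_nhdsWithin] with x hx using (h x hx).symm

/-- A nonnegative variable of mean 0 would have an atom at 0, which the continuous CDF excludes. -/
theorem mean_pos : 0 < M.mean i := by
  have := M.gen_prob i
  have h0 : 0 ≤ᵐ[M.gen i] fun t => t := by
    filter_upwards [M.gen_ae_mem i] with t ht using ht.1
  refine (integral_nonneg_of_ae h0).lt_of_ne' fun h => ?_
  have h1 := (integral_eq_zero_iff_of_nonneg_ae h0 (M.integrable_gen_id i)).1 h
  have h2 : M.gen i (Iic 0)ᶜ = 0 := by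
    refine measure_mono_null (fun t ht => ?_) h1
    have : 0 < t := by simpa using ht
    exact this.ne'
  rw [prob_compl_eq_zero_iff measurableSet_Iic] at h2
  have h3 := M.cdf_gen_zero i
  rw [cdf_eq_real, measureReal_def, h2] at h3
  simp at h3

section InvCDF

theorem invCDF_nonneg (u : ℝ) : 0 ≤ M.invCDF i u := Real.sInf_nonneg fun _ hx => hx.1

theorem bddBelow_invCDF_set (u : ℝ) : BddBelow {x : ℝ | 0 ≤ x ∧ u ≤ cdf (M.gen i) x} :=
  ⟨0, fun _ hx => hx.1⟩

/-- Continuity of the CDF makes the set closed, so its infimum is attained; `u < 1` makes it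
nonempty. -/
theorem le_cdf_invCDF {u : ℝ} (hu : u < 1) : u ≤ cdf (M.gen i) (M.invCDF i u) := by
  have hne : {x : ℝ | 0 ≤ x ∧ u ≤ cdf (M.gen i) x}.Nonempty := by
    obtain ⟨x, hx, hx'⟩ := ((eventually_ge_atTop (0 : ℝ)).and
      ((tendsto_cdf_atTop (M.gen i)).eventually (lt_mem_nhds hu))).exists
    exact ⟨x, hx, hx'.le⟩
  have hcl : IsClosed {x : ℝ | 0 ≤ x ∧ u ≤ cdf (M.gen i) x} :=
    (isClosed_le continuous_const continuous_id).inter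
      (isClosed_le continuous_const (M.gen_cont i))
  exact (hcl.csInf_mem hne (M.bddBelow_invCDF_set i u)).2

theorem invCDF_le_iff {u x : ℝ} (hu : u < 1) (hx : 0 ≤ x) :
    M.invCDF i u ≤ x ↔ u ≤ cdf (M.gen i) x :=
  ⟨fun h => (M.le_cdf_invCDF i hu).trans (monotone_cdf _ h),
    fun h => csInf_le (M.bddBelow_invCDF_set i u) ⟨hx, h⟩⟩

theorem cdf_invCDF {u : ℝ} (hu0 : 0 ≤ u) (hu : u < 1) : cdf (M.gen i) (M.invCDF i u) = u := by
  have h0 := M.invCDF_nonneg i u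
  obtain ⟨z, hz, hzu⟩ := intermediate_value_Icc h0 (M.gen_cont i).continuousOn
    (show u ∈ Icc _ _ from ⟨by rw [M.cdf_gen_zero]; exact hu0, M.le_cdf_invCDF i hu⟩)
  have : M.invCDF i u = z := le_antisymm ((M.invCDF_le_iff i hu hz.1).2 hzu.ge) hz.2
  rw [this, hzu]

end InvCDF

section Quantity

variable {i} {p x c : ℝ}

theorem qty_nonneg (s : Bool) (p : ℝ) : 0 ≤ M.qty i s p := by
  unfold qty
  split_ifs
  · exact (M.mean_pos i).le
  · exact M.invCDF_nonneg i _

theorem qty_le_iff (hp : p < M.lam) (hx : 0 ≤ x) :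
    M.qty i false p ≤ x ↔ p ≤ M.lam * cdf (M.gen i) x := by
  simp only [qty, Bool.false_eq_true, if_false]
  rw [M.invCDF_le_iff i ((div_lt_one M.lam_pos).2 hp) hx, div_le_iff₀' M.lam_pos]

theorem lt_qty_iff (hp : p < M.lam) (hx : 0 ≤ x) :
    x < M.qty i false p ↔ M.lam * cdf (M.gen i) x < p := by
  rw [← not_le, M.qty_le_iff hp hx, not_le]

theorem lam_mul_cdf_qty (hp0 : 0 ≤ p) (hp : p < M.lam) :
    M.lam * cdf (M.gen i) (M.qty i false p) = p := by
  simp only [qty, Bool.false_eq_true, if_false]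
  rw [M.cdf_invCDF i (div_nonneg hp0 M.lam_pos.le) ((div_lt_one M.lam_pos).2 hp)]
  exact mul_div_cancel₀ _ M.lam_pos.ne'

theorem qty_mono {p' : ℝ} (hpp : p ≤ p') (hp' : p' < M.lam) :
    M.qty i false p ≤ M.qty i false p' :=
  (M.qty_le_iff (hpp.trans_lt hp') (M.qty_nonneg _ _)).2
    (hpp.trans ((M.qty_le_iff hp' (M.qty_nonneg _ _)).1 le_rfl))

theorem qty_zero : M.qty i false 0 = 0 :=
  le_antisymm ((M.qty_le_iff M.lam_pos le_rfl).2
    (mul_nonneg M.lam_pos.le (cdf_nonneg _ _))) (M.qty_nonneg _ _)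

theorem qty_pos (hp0 : 0 < p) (hp : p < M.lam) : 0 < M.qty i false p := by
  rw [M.lt_qty_iff hp le_rfl, M.cdf_gen_zero, mul_zero]
  exact hp0

end Quantity

noncomputable section

/-- Expected shortfall of supplier `i` without storage who has committed to `x`. -/
def shortfall (x : ℝ) : ℝ := ∫ t, max (x - t) 0 ∂(M.gen i)

theorem revenue_false (p x : ℝ) : M.revenue i false p x = p * x - M.lam * M.shortfall i x := by
  simp [revenue, shortfall]

theorem integrable_shortfall (x : ℝ) : Integrable (fun t => max (x - t) 0) (M.gen i) := by
  have := M.gen_prob i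
  exact ((integrable_const x).sub (M.integrable_gen_id i)).sup (integrable_const 0)

theorem shortfall_nonneg (x : ℝ) : 0 ≤ M.shortfall i x :=
  integral_nonneg fun _ => le_max_right _ _

theorem shortfall_zero : M.shortfall i 0 = 0 := by
  refine integral_eq_zero_of_ae ?_
  filter_upwards [M.gen_ae_mem i] with t ht
  simpa using ht.1

theorem integral_indicator_Iic_gen (x c : ℝ) :
    ∫ t, (Iic x).indicator (fun _ => c) t ∂(M.gen i) = cdf (M.gen i) x * c := by
  have := M.gen_prob i
  rw [integral_indicator_const _ measurableSet_Iic, cdf_eq_real, smul_eq_mul]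

/-- With `shortfall_sub_le`, an integrated form of the fact that the derivative of the expected
shortfall is the CDF. -/
theorem shortfall_sub_ge {x x' : ℝ} (h : x ≤ x') :
    cdf (M.gen i) x * (x' - x) ≤ M.shortfall i x' - M.shortfall i x := by
  have := M.gen_prob i
  rw [← integral_indicator_Iic_gen, shortfall, shortfall,
    ← integral_sub (M.integrable_shortfall i x') (M.integrable_shortfall i x)]
  refine integral_mono ((integrable_const _).indicator measurableSet_Iic)
    ((M.integrable_shortfall i x').sub (M.integrable_shortfall i x)) fun t => ?_
  by_cases ht : t ≤ x
  · simp only [mem_Iic, ht, indicator_of_mem]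
    rw [max_eq_left (by linarith), max_eq_left (by linarith)]
    linarith
  · simp only [mem_Iic, ht, not_false_eq_true, indicator_of_notMem]
    exact sub_nonneg.2 (max_le_max_right _ (by linarith))

theorem shortfall_sub_le {x x' : ℝ} (h : x ≤ x') :
    M.shortfall i x' - M.shortfall i x ≤ cdf (M.gen i) x' * (x' - x) := by
  have := M.gen_prob i
  rw [← integral_indicator_Iic_gen, shortfall, shortfall,
    ← integral_sub (M.integrable_shortfall i x') (M.integrable_shortfall i x)]
  refine integral_mono ((M.integrable_shortfall i x').sub (M.integrable_shortfall i x))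
    ((integrable_const _).indicator measurableSet_Iic) fun t => ?_
  by_cases ht : t ≤ x'
  · simp only [mem_Iic, ht, indicator_of_mem]
    rw [max_eq_left (by linarith)]
    linarith [le_max_left (x - t) 0]
  · simp only [mem_Iic, ht, not_false_eq_true, indicator_of_notMem]
    rw [max_eq_right (by linarith), max_eq_right (by linarith)]
    simp

theorem shortfall_mono : Monotone (M.shortfall i) := fun x x' h => by
  have h1 := M.shortfall_sub_ge i h
  have h2 := mul_nonneg (cdf_nonneg (M.gen i) x) (sub_nonneg.2 h)
  linarith

theorem shortfall_le {x : ℝ} (hx : 0 ≤ x) : M.shortfall i x ≤ x := by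
  have h1 := M.shortfall_sub_le i hx
  have h2 := mul_le_mul_of_nonneg_right (cdf_le_one (M.gen i) x) hx
  rw [shortfall_zero] at h1
  linarith

/-- Revenue of supplier `i` without storage at price `p` if he can sell up to `c`. -/
def cappedRevenue (c p : ℝ) : ℝ := M.revenue i false p (min c (M.qty i false p))

variable {i} {p p' c : ℝ}

/-- Newsvendor optimality: the marginal revenue p − λF(x) is nonincreasing in x and vanishes at
y(p), so the best quantity up to c is min(c, y(p)). -/
theorem revenue_le_cappedRevenue {x : ℝ} (hp0 : 0 ≤ p) (hp : p < M.lam) (hxc : x ≤ c) :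
    M.revenue i false p x ≤ M.cappedRevenue i c p := by
  have hy := M.lam_mul_cdf_qty (i := i) hp0 hp
  rw [cappedRevenue, revenue_false, revenue_false]
  set y := M.qty i false p
  have hlam := M.lam_pos
  rcases le_total x y with hxy | hxy
  · have hxm : x ≤ min c y := le_min hxc hxy
    have h1 := M.shortfall_sub_le i hxm
    have h2 := monotone_cdf (M.gen i) (min_le_right c y)
    have h3 : M.lam * (M.shortfall i (min c y) - M.shortfall i x) ≤ p * (min c y - x) := by
      calc _ ≤ M.lam * (cdf (M.gen i) y * (min c y - x)) :=
            mul_le_mul_of_nonneg_left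
              (h1.trans (mul_le_mul_of_nonneg_right h2 (sub_nonneg.2 hxm))) hlam.le
        _ = _ := by rw [← mul_assoc, hy]
    linarith
  · rw [min_eq_right (hxy.trans hxc)]
    have h1 := mul_le_mul_of_nonneg_left (M.shortfall_sub_ge i hxy) hlam.le
    rw [← mul_assoc, hy] at h1
    linarith

/-- Envelope argument: the quantity that is optimal at p is still feasible at p'. -/
theorem cappedRevenue_sub_ge (hp : 0 ≤ p) (hpp : p ≤ p') (hp' : p' < M.lam) :
    (p' - p) * min c (M.qty i false p) ≤ M.cappedRevenue i c p' - M.cappedRevenue i c p := by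
  have h := M.revenue_le_cappedRevenue (i := i) (hp.trans hpp) hp'
    (min_le_left c (M.qty i false p))
  rw [revenue_false] at h
  rw [cappedRevenue.eq_def M i c p, revenue_false]
  linarith

theorem cappedRevenue_sub_le (hp : 0 ≤ p) (hpp : p ≤ p') (hp' : p' < M.lam) :
    M.cappedRevenue i c p' - M.cappedRevenue i c p ≤ (p' - p) * c := by
  have h := M.revenue_le_cappedRevenue (i := i) hp (hpp.trans_lt hp')
    (min_le_left c (M.qty i false p'))
  rw [revenue_false] at h
  have h2 := mul_le_mul_of_nonneg_left (min_le_left c (M.qty i false p')) (sub_nonneg.2 hpp)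
  rw [cappedRevenue.eq_def M i c p', revenue_false]
  linarith

theorem cappedRevenue_mono (hc : 0 ≤ c) (hp : 0 ≤ p) (hpp : p ≤ p') (hp' : p' < M.lam) :
    M.cappedRevenue i c p ≤ M.cappedRevenue i c p' := by
  have h1 := M.cappedRevenue_sub_ge (i := i) (c := c) hp hpp hp'
  have h2 := mul_nonneg (sub_nonneg.2 hpp) (le_min hc (M.qty_nonneg (i := i) false p))
  linarith

theorem cappedRevenue_strictMonoOn (hc : 0 < c) :
    StrictMonoOn (M.cappedRevenue i c) (Icc 0 M.pbar) := by
  intro p hp p' hp' hpp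
  -- The quantity vanishes at price 0, so the strict gain is taken from an intermediate r > 0.
  obtain ⟨r, hpr, hr⟩ := exists_between hpp
  have hlt := M.pbar_lt_lam
  have hr0 : 0 < r := hp.1.trans_lt hpr
  have hrl : r < M.lam := hr.trans (hp'.2.trans_lt hlt)
  have h1 := M.cappedRevenue_mono (i := i) hc.le hp.1 hpr.le hrl
  have h2 := M.cappedRevenue_sub_ge (i := i) (c := c) hr0.le hr.le (hp'.2.trans_lt hlt)
  have h3 := mul_pos (sub_pos.2 hr) (lt_min hc (M.qty_pos (i := i) hr0 hrl))
  linarith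

theorem cappedRevenue_continuousOn (hc : 0 ≤ c) :
    ContinuousOn (M.cappedRevenue i c) (Icc 0 M.pbar) := by
  have key : ∀ p ∈ Icc 0 M.pbar, ∀ p' ∈ Icc 0 M.pbar, p ≤ p' →
      |M.cappedRevenue i c p' - M.cappedRevenue i c p| ≤ c * |p' - p| := by
    intro p hp p' hp' hpp
    have hlt := hp'.2.trans_lt M.pbar_lt_lam
    rw [abs_of_nonneg (sub_nonneg.2 (M.cappedRevenue_mono hc hp.1 hpp hlt)),
      abs_of_nonneg (sub_nonneg.2 hpp), mul_comm]
    exact M.cappedRevenue_sub_le hp.1 hpp hlt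
  refine (LipschitzOnWith.of_dist_le_mul (K := ⟨c, hc⟩) fun p hp p' hp' => ?_).continuousOn
  rw [Real.dist_eq, Real.dist_eq]
  rcases le_total p p' with h | h
  · rw [abs_sub_comm, abs_sub_comm p]
    exact key p hp p' hp' h
  · exact key p' hp' p hp h

theorem cappedRevenue_zero (hc : 0 ≤ c) : M.cappedRevenue i c 0 = 0 := by
  rw [cappedRevenue, revenue_false, qty_zero, min_eq_right hc, shortfall_zero]
  simp

theorem cappedRevenue_cap_zero (p : ℝ) : M.cappedRevenue i 0 p = 0 := by
  rw [cappedRevenue, revenue_false, min_eq_left (M.qty_nonneg _ _), shortfall_zero]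
  simp

theorem cappedRevenue_cap_mono {c' : ℝ} (hcc : c ≤ c') (hp0 : 0 ≤ p) (hp : p < M.lam) :
    M.cappedRevenue i c p ≤ M.cappedRevenue i c' p :=
  M.revenue_le_cappedRevenue hp0 hp ((min_le_left _ _).trans hcc)

/-- Below y(p) the marginal revenue p − λF is positive, so relaxing a binding cap strictly pays. -/
theorem cappedRevenue_cap_lt {c' : ℝ} (hc : 0 ≤ c) (hcc : c < c') (hp0 : 0 ≤ p) (hp : p < M.lam)
    (hy : c < M.qty i false p) : M.cappedRevenue i c p < M.cappedRevenue i c' p := by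
  obtain ⟨z, hcz, hz⟩ := exists_between (lt_min hcc hy)
  have hzy := hz.trans_le (min_le_right _ _)
  refine lt_of_lt_of_le ?_ (M.revenue_le_cappedRevenue hp0 hp (hz.le.trans (min_le_left _ _)))
  rw [cappedRevenue, revenue_false, revenue_false, min_eq_left hy.le]
  have h1 := M.shortfall_sub_le i hcz.le
  have h2 := (M.lt_qty_iff (i := i) hp (hc.trans hcz.le)).1 hzy
  have h3 := mul_le_mul_of_nonneg_left h1 M.lam_pos.le
  have h4 := mul_lt_mul_of_pos_right h2 (sub_pos.2 hcz)
  linarith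

/-- Raising the cap raises the revenue by at most the value of the additional sales. -/
theorem cappedRevenue_cap_sub_le {c' : ℝ} (hcc : c ≤ c') :
    M.cappedRevenue i c' p - M.cappedRevenue i c p
      ≤ p * (min c' (M.qty i false p) - min c (M.qty i false p)) := by
  rw [cappedRevenue, cappedRevenue, revenue_false, revenue_false]
  have h1 := mul_le_mul_of_nonneg_left
    (M.shortfall_mono i (min_le_min_right (M.qty i false p) hcc)) M.lam_pos.le
  linarith

end

end Market

end EnergyMarket

/-! ### Measurability of payoffs and deviations to pure prices -/

namespace EnergyMarket

namespace Market

open Filter Topology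

noncomputable section

variable (M : Market)

/-- The nearest admissible price. -/
def clamp (x : ℝ) : ℝ := max 0 (min x M.pbar)

theorem clamp_mem (x : ℝ) : M.clamp x ∈ Icc 0 M.pbar :=
  ⟨le_max_left _ _, max_le M.pbar_pos.le (min_le_right _ _)⟩

theorem clamp_eq {x : ℝ} (hx : x ∈ Icc 0 M.pbar) : M.clamp x = x := by
  rw [clamp, min_eq_left hx.2, max_eq_right hx.1]

theorem clamp_mono : Monotone M.clamp := fun _ _ h => max_le_max_left _ (min_le_min_right _ h)

theorem measurable_clamp : Measurable M.clamp := M.clamp_mono.measurable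

/-- Monotonicity of `qty` is available only below λ: for prices above λ the set defining `invCDF` is
empty and its `sInf` is 0. Clamping avoids this and changes nothing almost surely. -/
theorem measurable_qty_clamp (i : Fin 2) (s : Bool) :
    Measurable fun x => M.qty i s (M.clamp x) := by
  cases s
  · refine Monotone.measurable fun x y h => M.qty_mono (M.clamp_mono h) ?_
    exact (M.clamp_mem y).2.trans_lt M.pbar_lt_lam
  · simp only [qty, if_true]
    exact measurable_const

theorem measurable_revenue (i : Fin 2) (s : Bool) {f g : ℝ × ℝ → ℝ} (hf : Measurable f)
    (hg : Measurable g) : Measurable fun z => M.revenue i s (f z) (g z) := by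
  cases s
  · simp only [revenue_false]
    exact (hf.mul hg).sub (((M.shortfall_mono i).measurable.comp hg).const_mul _)
  · simp only [revenue, if_true]
    exact (hf.mul hg).sub (((hg.sub_const _).max measurable_const).const_mul _)

variable (φ : Fin 2 → Bool) (i : Fin 2)

theorem measurable_revFirst_clamp {f : ℝ × ℝ → ℝ} (hf : Measurable f) :
    Measurable fun z => M.revFirst φ i (M.clamp (f z)) :=
  M.measurable_revenue i _ (M.measurable_clamp.comp hf)
    (measurable_const.min ((M.measurable_qty_clamp i _).comp hf))

theorem measurable_revSecond_clamp {f g : ℝ × ℝ → ℝ} (hf : Measurable f) (hg : Measurable g) :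
    Measurable fun z => M.revSecond φ i (M.clamp (f z)) (M.clamp (g z)) :=
  M.measurable_revenue i _ (M.measurable_clamp.comp hf)
    ((measurable_const.sub (measurable_const.min
      ((M.measurable_qty_clamp _ _).comp hg))).min ((M.measurable_qty_clamp i _).comp hf))

theorem measurable_payoff_clamp :
    Measurable fun z : ℝ × ℝ => M.payoff φ i (M.clamp z.1) (M.clamp z.2) := by
  have h1 : Measurable fun z : ℝ × ℝ => M.clamp z.1 := M.measurable_clamp.comp measurable_fst
  have h2 : Measurable fun z : ℝ × ℝ => M.clamp z.2 := M.measurable_clamp.comp measurable_snd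
  have hF := fun j => M.measurable_revFirst_clamp φ j (f := Prod.fst) measurable_fst
  have hS := M.measurable_revSecond_clamp φ i (f := Prod.fst) measurable_fst measurable_snd
  have hT : ∀ j, Measurable fun z : ℝ × ℝ => M.tieTotal φ j (M.clamp z.1) := fun j =>
    (hF j).add (M.measurable_revSecond_clamp φ _ measurable_fst measurable_fst)
  exact Measurable.ite (measurableSet_lt h1 h2) (hF i) <|
    Measurable.ite (measurableSet_lt h2 h1) hS <|
    Measurable.ite (measurableSet_lt (hT _) (hT _)) (hF i) <|
    Measurable.ite (measurableSet_lt (hT _) (hT _)) hS (((hF i).add hS).div_const 2)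

theorem abs_revenue_le (s : Bool) {p x : ℝ} (hp : p ∈ Icc 0 M.pbar) (hx : x ∈ Icc 0 M.D) :
    |M.revenue i s p x| ≤ M.pbar * M.D + M.lam * M.D := by
  have hlam := M.lam_pos
  have h1 : p * x ≤ M.pbar * M.D := mul_le_mul hp.2 hx.2 hx.1 M.pbar_pos.le
  have h2 : 0 ≤ p * x := mul_nonneg hp.1 hx.1
  obtain ⟨k, hk0, hk, hrev⟩ : ∃ k, 0 ≤ k ∧ k ≤ x ∧ M.revenue i s p x = p * x - M.lam * k := by
    cases s
    · exact ⟨_, M.shortfall_nonneg i x, M.shortfall_le i hx.1, M.revenue_false i p x⟩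
    · refine ⟨max (x - M.mean i) 0, le_max_right _ _, max_le ?_ hx.1, by simp [revenue]⟩
      linarith [M.mean_pos i]
  have h3 := mul_le_mul_of_nonneg_left (hk.trans hx.2) hlam.le
  have h4 := mul_nonneg hlam.le hk0
  rw [hrev, abs_le]
  constructor <;> linarith

variable {i}

theorem abs_payoff_le (hD : 0 < M.D) {p p' : ℝ} (hp : p ∈ Icc 0 M.pbar) :
    |M.payoff φ i p p'| ≤ M.pbar * M.D + M.lam * M.D := by
  have hF : |M.revFirst φ i p| ≤ M.pbar * M.D + M.lam * M.D :=
    M.abs_revenue_le i _ hp ⟨le_min hD.le (M.qty_nonneg _ _), min_le_left _ _⟩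
  have hS : |M.revSecond φ i p p'| ≤ M.pbar * M.D + M.lam * M.D := by
    refine M.abs_revenue_le i _ hp
      ⟨le_min (sub_nonneg.2 (min_le_left _ _)) (M.qty_nonneg _ _), (min_le_left _ _).trans ?_⟩
    exact sub_le_self _ (le_min hD.le (M.qty_nonneg _ _))
  unfold payoff
  split_ifs
  · exact hF
  · exact hS
  · exact hF
  · exact hS
  · rw [abs_le] at hF hS ⊢
    constructor <;> linarith

variable {φ} {ν ν' : Measure ℝ}

theorem IsPriceStrategy.ae_mem {M : Market} {ν : Measure ℝ} (h : M.IsPriceStrategy ν) :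
    ∀ᵐ p ∂ν, p ∈ Icc 0 M.pbar := h.2

theorem integrable_payoff (hD : 0 < M.D) (hν : M.IsPriceStrategy ν) (hν' : M.IsPriceStrategy ν') :
    Integrable (fun z : ℝ × ℝ => M.payoff φ i z.1 z.2) (ν.prod ν') := by
  have := hν.1
  have := hν'.1
  have h1 : ∀ᵐ z ∂(ν.prod ν'), z.1 ∈ Icc 0 M.pbar :=
    Measure.quasiMeasurePreserving_fst.ae hν.ae_mem
  have h2 : ∀ᵐ z ∂(ν.prod ν'), z.2 ∈ Icc 0 M.pbar :=
    Measure.quasiMeasurePreserving_snd.ae hν'.ae_mem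
  refine Integrable.of_bound ((M.measurable_payoff_clamp φ i).aestronglyMeasurable.congr ?_)
    (M.pbar * M.D + M.lam * M.D) ?_
  · filter_upwards [h1, h2] with z hz1 hz2
    rw [M.clamp_eq hz1, M.clamp_eq hz2]
  · filter_upwards [h1] with z hz1
    exact M.abs_payoff_le φ hD hz1

theorem integrable_payoff_right (hD : 0 < M.D) (hν' : M.IsPriceStrategy ν') {p : ℝ}
    (hp : p ∈ Icc 0 M.pbar) : Integrable (M.payoff φ i p) ν' := by
  have := hν'.1
  refine Integrable.of_bound (((M.measurable_payoff_clamp φ i).comp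
    (measurable_prodMk_left (x := p))).aestronglyMeasurable.congr ?_)
    (M.pbar * M.D + M.lam * M.D) (Eventually.of_forall fun z => M.abs_payoff_le φ hD hp)
  filter_upwards [hν'.ae_mem] with z hz
  simp only [Function.comp_apply, M.clamp_eq hp, M.clamp_eq hz]

variable (φ i) in
/-- Expected revenue of supplier `i` from the pure price `p` against a rival who plays `κ`. -/
def pureRevenue (κ : Measure ℝ) (p : ℝ) : ℝ := ∫ r, M.payoff φ i p r ∂κ

theorem expRevenue_eq (hD : 0 < M.D) (hν : M.IsPriceStrategy ν) (hν' : M.IsPriceStrategy ν') :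
    M.expRevenue φ i ν ν' = ∫ p, M.pureRevenue φ i ν' p ∂ν := by
  have := hν.1
  have := hν'.1
  exact integral_prod _ (M.integrable_payoff hD hν hν')

theorem isPriceStrategy_dirac {p : ℝ} (hp : p ∈ Icc 0 M.pbar) :
    M.IsPriceStrategy (Measure.dirac p) := by
  refine ⟨inferInstance, ?_⟩
  rw [Measure.dirac_apply' _ measurableSet_Icc.compl]
  simpa using hp

variable {M} {μ : Fin 2 → Measure ℝ}

theorem IsMixedEquilibrium.pureRevenue_le (hμ : M.IsMixedEquilibrium φ μ) (hD : 0 < M.D) {p : ℝ}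
    (hp : p ∈ Icc 0 M.pbar) : M.pureRevenue φ i (μ (rival i)) p ≤ M.eqRevenue φ μ i := by
  have h := hμ.2 i _ (M.isPriceStrategy_dirac hp)
  rwa [M.expRevenue_eq hD (M.isPriceStrategy_dirac hp) (hμ.1 _), integral_dirac] at h

/-- The equilibrium revenue is the μ_i-average of pure revenues that never exceed it, so almost all
of them equal it. -/
theorem IsMixedEquilibrium.pureRevenue_ae (hμ : M.IsMixedEquilibrium φ μ) (hD : 0 < M.D) :
    ∀ᵐ p ∂(μ i), M.pureRevenue φ i (μ (rival i)) p = M.eqRevenue φ μ i := by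
  have := (hμ.1 i).1
  have := (hμ.1 (rival i)).1
  have hint : Integrable (M.pureRevenue φ i (μ (rival i))) (μ i) :=
    (M.integrable_payoff hD (hμ.1 i) (hμ.1 (rival i))).integral_prod_left
  have h0 : 0 ≤ᵐ[μ i] fun p => M.eqRevenue φ μ i - M.pureRevenue φ i (μ (rival i)) p := by
    filter_upwards [(hμ.1 i).ae_mem] with p hp
    exact sub_nonneg.2 (hμ.pureRevenue_le hD hp)
  have h1 : ∫ p, (M.eqRevenue φ μ i - M.pureRevenue φ i (μ (rival i)) p) ∂(μ i) = 0 := by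
    rw [integral_sub (integrable_const _) hint, ← M.expRevenue_eq hD (hμ.1 i) (hμ.1 (rival i))]
    simp [eqRevenue]
  have h2 := (integral_eq_zero_iff_of_nonneg_ae h0 ((integrable_const _).sub hint)).1 h1
  filter_upwards [h2] with p hp
  exact (sub_eq_zero.1 hp).symm

end

end Market

end EnergyMarket

/-! ### Recovering a measure from a weighted copy -/

namespace EnergyMarket

/-- If the measure with density `g` with respect to `μ` has Lebesgue density `f` on `(l, p]`, then
`μ` has Lebesgue density `f / g` there. -/
theorem measureReal_Ioc_eq_integral_div {μ : Measure ℝ} [IsFiniteMeasure μ] {f g : ℝ → ℝ}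
    (hf : Measurable f) (hg : Measurable g) {l p : ℝ} (hlp : l ≤ p)
    (hf0 : ∀ t ∈ Ioc l p, 0 ≤ f t) (hg0 : ∀ t ∈ Ioc l p, 0 < g t)
    (hfi : IntervalIntegrable f volume l p)
    (h : ∀ x ∈ Icc l p, (μ.withDensity fun t => ENNReal.ofReal (g t)) (Ioc l x) =
      ENNReal.ofReal (∫ t in l..x, f t)) :
    IntervalIntegrable (fun t => f t / g t) volume l p ∧
      μ.real (Ioc l p) = ∫ t in l..p, f t / g t := by
  have hgm : Measurable fun t => ENNReal.ofReal (g t) := hg.ennreal_ofReal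
  have hfm : Measurable fun t => ENNReal.ofReal (f t) := hf.ennreal_ofReal
  have hgi : Measurable fun t => (ENNReal.ofReal (g t))⁻¹ := hgm.inv
  have hfin : (volume.restrict (Ioc l p)).withDensity (fun t => ENNReal.ofReal (f t)) =
      (μ.restrict (Ioc l p)).withDensity (fun t => ENNReal.ofReal (g t)) := by
    have hfi' : IntegrableOn f (Ioc l p) :=
      (intervalIntegrable_iff_integrableOn_Ioc_of_le hlp).1 hfi
    have : IsFiniteMeasure ((volume.restrict (Ioc l p)).withDensity
        (fun t => ENNReal.ofReal (f t))) := isFiniteMeasure_withDensity_ofReal hfi'.2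
    -- Both measures live on (l, p] and are finite, so comparing them on half-lines suffices.
    refine Measure.ext_of_Iic _ _ fun x => ?_
    have hinter : Iic x ∩ Ioc l p = Ioc l (min p x) := by
      rw [inter_comm, Ioc_inter_Iic]
    rw [withDensity_apply _ measurableSet_Iic, Measure.restrict_restrict measurableSet_Iic,
      ← restrict_withDensity measurableSet_Ioc, Measure.restrict_apply measurableSet_Iic, hinter]
    rcases le_total (min p x) l with hx | hx
    · simp [Ioc_eq_empty_of_le hx]
    · have hsub : Ioc l (min p x) ⊆ Ioc l p := Ioc_subset_Ioc_right (min_le_left _ _)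
      rw [h _ ⟨hx, min_le_left _ _⟩, intervalIntegral.integral_of_le hx,
        ofReal_integral_eq_lintegral_ofReal (hfi'.mono_set hsub)]
      filter_upwards [ae_restrict_mem measurableSet_Ioc] with t ht using hf0 t (hsub ht)
  have hinv : (μ.restrict (Ioc l p)) = ((volume.restrict (Ioc l p)).withDensity
      (fun t => ENNReal.ofReal (f t))).withDensity (fun t => (ENNReal.ofReal (g t))⁻¹) := by
    rw [hfin, withDensity_inv_same hgm]
    · filter_upwards [ae_restrict_mem measurableSet_Ioc] with t ht
      simpa using hg0 t ht
    · exact Filter.Eventually.of_forall fun t => ENNReal.ofReal_ne_top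
  have hmass : μ (Ioc l p) = ∫⁻ t in Ioc l p, ENNReal.ofReal (f t / g t) := by
    rw [← Measure.restrict_apply_univ, hinv, withDensity_apply _ MeasurableSet.univ,
      Measure.restrict_univ, lintegral_withDensity_eq_lintegral_mul _ hfm hgi]
    refine setLIntegral_congr_fun measurableSet_Ioc fun t ht => ?_
    rw [ENNReal.ofReal_div_of_pos (hg0 t ht)]
    rfl
  have hnn : 0 ≤ᵐ[volume.restrict (Ioc l p)] fun t => f t / g t := by
    filter_upwards [ae_restrict_mem measurableSet_Ioc] with t ht
    exact div_nonneg (hf0 t ht) (hg0 t ht).le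
  constructor
  · rw [intervalIntegrable_iff_integrableOn_Ioc_of_le hlp]
    refine ⟨(hf.div hg).aestronglyMeasurable, ?_⟩
    -- Integrability of f / g needs no bound on 1 / g: its integral is a mass of the finite measure
    -- μ.
    rw [hasFiniteIntegral_iff_ofReal hnn, ← hmass]
    exact measure_lt_top _ _
  · rw [intervalIntegral.integral_of_le hlp,
      integral_eq_lintegral_of_nonneg_ae hnn (hf.div hg).aestronglyMeasurable, ← hmass]
    rfl

theorem integral_const_div_sq {l x c : ℝ} (hl : 0 < l) (hx : l ≤ x) :
    IntervalIntegrable (fun t => c / t ^ 2) volume l x ∧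
      ∫ t in l..x, c / t ^ 2 = c / l - c / x := by
  have hpos : ∀ t ∈ uIcc l x, t ≠ 0 := fun t ht => by
    rw [uIcc_of_le hx] at ht
    exact (hl.trans_le ht.1).ne'
  have hint : IntervalIntegrable (fun t => c / t ^ 2) volume l x := by
    refine ContinuousOn.intervalIntegrable (continuousOn_const.div (by fun_prop) fun t ht => ?_)
    exact pow_ne_zero 2 (hpos t ht)
  refine ⟨hint, ?_⟩
  rw [intervalIntegral.integral_eq_sub_of_hasDerivAt (f := fun t => -(c / t)) (fun t ht => ?_) hint]
  · ring
  · have h := ((hasDerivAt_inv (hpos t ht)).const_mul c).neg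
    refine (h.congr_deriv ?_).congr_of_eventuallyEq ?_
    · field_simp
    · exact Filter.Eventually.of_forall fun s => by simp [div_eq_mul_inv]

/-! ### Payoffs when exactly one supplier has storage -/

namespace Market

noncomputable section

variable (M : Market) {φ : Fin 2 → Bool} {S N : Fin 2}

variable (S N) in
/-- Sales that supplier `S` with storage loses if supplier `N` without storage undercuts him at the
price `p`. -/
def lostSales (p : ℝ) : ℝ :=
  min M.D (M.qty N false p) - min (M.D - min M.D (M.mean S)) (M.qty N false p)

theorem lostSales_nonneg (hD : 0 < M.D) (p : ℝ) : 0 ≤ M.lostSales S N p :=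
  sub_nonneg.2 (min_le_min_right _ (sub_le_self _ (le_min hD.le (M.mean_pos S).le)))

theorem lostSales_le (p : ℝ) (hD : 0 < M.D) : M.lostSales S N p ≤ min M.D (M.mean S) := by
  have h1 := M.qty_nonneg (i := N) false p
  have h2 := le_min hD.le (M.mean_pos S).le
  have h3 : min M.D (M.mean S) ≤ M.D := min_le_left _ _
  unfold lostSales
  rcases min_cases M.D (M.qty N false p) with h | h <;>
  rcases min_cases (M.D - min M.D (M.mean S)) (M.qty N false p) with h' | h' <;> linarith

theorem lostSales_pos {p : ℝ} (hD : 0 < M.D)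
    (hp : M.D - min M.D (M.mean S) < M.qty N false p) : 0 < M.lostSales S N p := by
  have h2 := lt_min hD (M.mean_pos S)
  rw [lostSales, min_eq_left hp.le, sub_pos]
  exact lt_min (by linarith) hp

theorem measurable_lostSales_clamp : Measurable fun t => M.lostSales S N (M.clamp t) :=
  (measurable_const.min (M.measurable_qty_clamp N false)).sub
    (measurable_const.min (M.measurable_qty_clamp N false))

section Payoffs

variable {p p' : ℝ}

theorem revenue_true_of_le {x : ℝ} (hx : x ≤ M.mean S) : M.revenue S true p x = p * x := by
  simp [revenue, hx]

theorem revFirst_storage (hS : φ S = true) : M.revFirst φ S p = p * min M.D (M.mean S) := by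
  have : M.qty S true p = M.mean S := by simp [qty]
  rw [revFirst, hS, this, M.revenue_true_of_le (min_le_right _ _)]

/-- Total sales are min(D, E[X_S] + y_N) in either order, so what `S` loses by coming second is
exactly what `N` gains by coming first. -/
theorem revSecond_storage (hS : φ S = true) (hN : φ N = false) (hSN : rival S = N) (hD : 0 < M.D) :
    M.revSecond φ S p p' = p * (min M.D (M.mean S) - M.lostSales S N p') := by
  have h : M.qty S true p = M.mean S := by simp [qty]
  rw [revSecond, hSN, hS, hN, h, M.revenue_true_of_le (min_le_right _ _), lostSales]
  congr 1
  have h1 := M.qty_nonneg (i := N) false p'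
  have h2 := M.mean_pos S
  generalize M.qty N false p' = y at *
  generalize M.mean S = m at *
  generalize M.D = D at *
  rcases le_total D m with h | h
  · rw [min_eq_left h, sub_self, min_eq_left h1, min_eq_left]
    · ring
    · linarith [le_min hD.le h1]
  · rw [min_eq_right h]
    rcases le_total D y with h3 | h3
    · rw [min_eq_left h3, sub_self, min_eq_left h2.le, min_eq_left (by linarith)]
      ring
    · rw [min_eq_right h3]
      rcases le_total (D - m) y with h4 | h4
      · rw [min_eq_left h4, min_eq_left (by linarith)]
        ring
      · rw [min_eq_right h4, min_eq_right (by linarith)]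
        ring

theorem revFirst_noStorage (hN : φ N = false) : M.revFirst φ N p = M.cappedRevenue N M.D p := by
  rw [revFirst, hN, cappedRevenue]

theorem revSecond_noStorage (hS : φ S = true) (hN : φ N = false) (hNS : rival N = S) :
    M.revSecond φ N p p' = M.cappedRevenue N (M.D - min M.D (M.mean S)) p := by
  rw [revSecond, hNS, hN, hS, cappedRevenue]
  simp [qty]

/-- Swapping the order preserves total sales, hence the income at a common price. `S` never pays a
penalty, and the shortfall of `N` grows with his sales, so serving `S` first is at least as good. -/
theorem tieTotal_noStorage_le (hS : φ S = true) (hN : φ N = false) (hSN : rival S = N)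
    (hNS : rival N = S) (hD : 0 < M.D) : M.tieTotal φ N p ≤ M.tieTotal φ S p := by
  rw [tieTotal, tieTotal, hSN, hNS, M.revFirst_storage hS, M.revFirst_noStorage hN,
    M.revSecond_noStorage hS hN hNS, M.revSecond_storage hS hN hSN hD]
  have h := M.cappedRevenue_cap_sub_le (i := N) (p := p)
    (sub_le_self M.D (le_min hD.le (M.mean_pos S).le))
  rw [← lostSales] at h
  linarith

theorem payoff_storage_ge (hS : φ S = true) (hN : φ N = false) (hSN : rival S = N) (hD : 0 < M.D)
    (hp : 0 ≤ p) :
    p * min M.D (M.mean S) - p * (Iic p).indicator (M.lostSales S N) p' ≤ M.payoff φ S p p' := by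
  have h := mul_nonneg hp (M.lostSales_nonneg (S := S) (N := N) hD p')
  have hF := M.revFirst_storage hS (p := p)
  have hSd := M.revSecond_storage hS hN hSN hD (p := p) (p' := p')
  unfold payoff
  by_cases hpp : p' ≤ p
  · rw [indicator_of_mem (mem_Iic.2 hpp), if_neg (not_lt.2 hpp), hF, hSd]
    split_ifs <;> linarith
  · rw [indicator_of_notMem (by simpa using hpp), if_pos (not_le.1 hpp), hF]
    linarith

theorem payoff_storage_le (hS : φ S = true) (hN : φ N = false) (hSN : rival S = N) (hD : 0 < M.D)
    (hp : 0 ≤ p) :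
    M.payoff φ S p p' ≤ p * min M.D (M.mean S) - p * (Iio p).indicator (M.lostSales S N) p' := by
  have h := mul_nonneg hp (M.lostSales_nonneg (S := S) (N := N) hD p')
  have hF := M.revFirst_storage hS (p := p)
  have hSd := M.revSecond_storage hS hN hSN hD (p := p) (p' := p')
  unfold payoff
  by_cases hpp : p' < p
  · rw [indicator_of_mem (mem_Iio.2 hpp), if_neg (not_lt.2 hpp.le), if_pos hpp, hSd]
    linarith
  · rw [indicator_of_notMem (by simpa using hpp), hF, hSd]
    split_ifs <;> linarith

theorem payoff_noStorage_ge (hS : φ S = true) (hN : φ N = false) (hNS : rival N = S) (hD : 0 < M.D)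
    (hp : 0 ≤ p) (hp' : p < M.lam) :
    M.cappedRevenue N M.D p - (Iic p).indicator (fun _ => M.cappedRevenue N M.D p
      - M.cappedRevenue N (M.D - min M.D (M.mean S)) p) p' ≤ M.payoff φ N p p' := by
  have h := M.cappedRevenue_cap_mono (i := N)
    (sub_le_self M.D (le_min hD.le (M.mean_pos S).le)) hp hp'
  have hF := M.revFirst_noStorage hN (p := p)
  have hSd := M.revSecond_noStorage hS hN hNS (p := p) (p' := p')
  unfold payoff
  by_cases hpp : p' ≤ p
  · rw [indicator_of_mem (mem_Iic.2 hpp), if_neg (not_lt.2 hpp), hF, hSd]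
    split_ifs <;> linarith
  · rw [indicator_of_notMem (by simpa using hpp), if_pos (not_le.1 hpp), hF]
    linarith

/-- By `tieTotal_noStorage_le`, `N` is first in a tie with probability at most 1/2, whence the half
weight at p. This is the bound that excludes common atoms. -/
theorem payoff_noStorage_le (hS : φ S = true) (hN : φ N = false) (hSN : rival S = N)
    (hNS : rival N = S) (hD : 0 < M.D) (hp : 0 ≤ p) (hp' : p < M.lam) :
    M.payoff φ N p p' ≤ M.cappedRevenue N M.D p - ((Iio p).indicator (fun _ =>
      M.cappedRevenue N M.D p - M.cappedRevenue N (M.D - min M.D (M.mean S)) p) p' +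
      ({p} : Set ℝ).indicator (fun _ => (M.cappedRevenue N M.D p
        - M.cappedRevenue N (M.D - min M.D (M.mean S)) p) / 2) p') := by
  have h := M.cappedRevenue_cap_mono (i := N)
    (sub_le_self M.D (le_min hD.le (M.mean_pos S).le)) hp hp'
  have hF := M.revFirst_noStorage hN (p := p)
  have hSd := M.revSecond_noStorage hS hN hNS (p := p) (p' := p')
  unfold payoff
  rcases lt_trichotomy p p' with hlt | rfl | hlt
  · rw [indicator_of_notMem (by simpa using hlt.le), indicator_of_notMem (by simpa using hlt.ne'),
      if_pos hlt, hF]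
    linarith
  · have ht := M.tieTotal_noStorage_le hS hN hSN hNS hD (p := p)
    rw [indicator_of_notMem (by simp), indicator_of_mem (mem_singleton _), if_neg (lt_irrefl _),
      if_neg (lt_irrefl _), hNS, if_neg (not_lt.2 ht), hF, hSd]
    split_ifs <;> linarith
  · rw [indicator_of_mem (mem_Iio.2 hlt), indicator_of_notMem (by simpa using hlt.ne),
      if_neg (not_lt.2 hlt.le), if_pos hlt, hSd]
    linarith

end Payoffs

end

end Market

end EnergyMarket

/-! ### The market as an undercutting game -/

namespace EnergyMarket

namespace Market

noncomputable section

variable (M : Market) {φ : Fin 2 → Bool} {S N : Fin 2} {μ : Fin 2 → Measure ℝ}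

variable (S N μ) in
/-- The law of the price of supplier `N`, weighted by the sales that it costs supplier `S`. -/
def lossMeasure : Measure ℝ :=
  (μ N).withDensity fun t => ENNReal.ofReal (M.lostSales S N (M.clamp t))

theorem lossMeasure_le (hD : 0 < M.D) (s : Set ℝ) :
    M.lossMeasure S N μ s ≤ ENNReal.ofReal (min M.D (M.mean S)) * μ N s := by
  have h : M.lossMeasure S N μ ≤
      (μ N).withDensity fun _ => ENNReal.ofReal (min M.D (M.mean S)) :=
    withDensity_mono (Filter.Eventually.of_forall fun t =>
      ENNReal.ofReal_le_ofReal (M.lostSales_le _ hD))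
  rw [withDensity_const] at h
  exact h s

theorem lossMeasure_singleton (p : ℝ) : M.lossMeasure S N μ {p} =
    ENNReal.ofReal (M.lostSales S N (M.clamp p)) * μ N {p} := by
  rw [lossMeasure, withDensity_apply _ (measurableSet_singleton p), lintegral_singleton]

theorem integrable_lostSales_clamp [IsFiniteMeasure (μ N)] (hD : 0 < M.D) :
    Integrable (fun t => M.lostSales S N (M.clamp t)) (μ N) := by
  refine Integrable.of_bound M.measurable_lostSales_clamp.aestronglyMeasurable
    (min M.D (M.mean S)) (Filter.Eventually.of_forall fun t => ?_)
  rw [Real.norm_eq_abs, abs_of_nonneg (M.lostSales_nonneg hD _)]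
  exact M.lostSales_le _ hD

theorem isFiniteMeasure_lossMeasure [IsFiniteMeasure (μ N)] (hD : 0 < M.D) :
    IsFiniteMeasure (M.lossMeasure S N μ) :=
  isFiniteMeasure_withDensity_ofReal (M.integrable_lostSales_clamp hD).2

theorem lossMeasure_real (hD : 0 < M.D) {s : Set ℝ} (hs : MeasurableSet s) :
    (M.lossMeasure S N μ).real s =
      ∫ t, s.indicator (fun t => M.lostSales S N (M.clamp t)) t ∂(μ N) := by
  rw [measureReal_def, lossMeasure, withDensity_apply _ hs, integral_indicator hs,
    integral_eq_lintegral_of_nonneg_ae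
      (Filter.Eventually.of_forall fun t => M.lostSales_nonneg hD _)
      M.measurable_lostSales_clamp.aestronglyMeasurable]

section PureRevenue

variable {p : ℝ}

theorem integral_sub_mul_lossMeasure (hμ : M.IsPriceStrategy (μ N)) (hD : 0 < M.D) {s : Set ℝ}
    (hs : MeasurableSet s) (p b : ℝ) :
    Integrable (fun p' => p * b - p * s.indicator (M.lostSales S N) p') (μ N) ∧
      ∫ p', (p * b - p * s.indicator (M.lostSales S N) p') ∂(μ N) =
        p * (b - (M.lossMeasure S N μ).real s) := by
  have := hμ.1
  have hae : (fun p' => p * b - p * s.indicator (fun t => M.lostSales S N (M.clamp t)) p') =ᵐ[μ N]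
      fun p' => p * b - p * s.indicator (M.lostSales S N) p' := by
    filter_upwards [hμ.ae_mem] with t ht
    simp only [indicator, M.clamp_eq ht]
  have hi := ((M.integrable_lostSales_clamp (S := S) (μ := μ) (N := N) hD).indicator hs).const_mul p
  refine ⟨((integrable_const _).sub hi).congr hae, ?_⟩
  rw [← integral_congr_ae hae, integral_sub (integrable_const _) hi, integral_const_mul,
    integral_const_mul, ← M.lossMeasure_real hD hs]
  simp only [integral_const, probReal_univ, smul_eq_mul]
  ring

theorem pureRevenue_storage_ge (hμ : M.IsPriceStrategy (μ N)) (hS : φ S = true) (hN : φ N = false)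
    (hSN : rival S = N) (hD : 0 < M.D) (hp : p ∈ Icc 0 M.pbar) :
    p * (min M.D (M.mean S) - (M.lossMeasure S N μ).real (Iic p)) ≤ M.pureRevenue φ S (μ N) p := by
  obtain ⟨hi, he⟩ := M.integral_sub_mul_lossMeasure (S := S) hμ hD (measurableSet_Iic (a := p)) p
    (min M.D (M.mean S))
  rw [← he]
  exact integral_mono hi (M.integrable_payoff_right hD hμ hp)
    fun p' => M.payoff_storage_ge hS hN hSN hD hp.1

theorem pureRevenue_storage_le (hμ : M.IsPriceStrategy (μ N)) (hS : φ S = true) (hN : φ N = false)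
    (hSN : rival S = N) (hD : 0 < M.D) (hp : p ∈ Icc 0 M.pbar) :
    M.pureRevenue φ S (μ N) p ≤ p * (min M.D (M.mean S) - (M.lossMeasure S N μ).real (Iio p)) := by
  obtain ⟨hi, he⟩ := M.integral_sub_mul_lossMeasure (S := S) hμ hD (measurableSet_Iio (a := p)) p
    (min M.D (M.mean S))
  rw [← he]
  exact integral_mono (M.integrable_payoff_right hD hμ hp) hi
    fun p' => M.payoff_storage_le hS hN hSN hD hp.1

theorem pureRevenue_noStorage_ge (hμ : M.IsPriceStrategy (μ S)) (hS : φ S = true)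
    (hN : φ N = false) (hNS : rival N = S) (hD : 0 < M.D) (hp : p ∈ Icc 0 M.pbar) :
    M.cappedRevenue N M.D p - (M.cappedRevenue N M.D p
      - M.cappedRevenue N (M.D - min M.D (M.mean S)) p) * (μ S).real (Iic p) ≤
      M.pureRevenue φ N (μ S) p := by
  have := hμ.1
  have hi : ∀ {s : Set ℝ} (c : ℝ), MeasurableSet s → Integrable (s.indicator fun _ => c) (μ S) :=
    fun c hs => (integrable_const c).indicator hs
  refine le_trans (le_of_eq ?_) (integral_mono
    ((integrable_const _).sub (hi _ measurableSet_Iic)) (M.integrable_payoff_right hD hμ hp)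
    fun p' => M.payoff_noStorage_ge hS hN hNS hD hp.1 (hp.2.trans_lt M.pbar_lt_lam))
  rw [integral_sub' (integrable_const _) (hi _ measurableSet_Iic),
    integral_indicator_const _ measurableSet_Iic]
  simp [mul_comm]

theorem pureRevenue_noStorage_le (hμ : M.IsPriceStrategy (μ S)) (hS : φ S = true)
    (hN : φ N = false) (hSN : rival S = N) (hNS : rival N = S) (hD : 0 < M.D)
    (hp : p ∈ Icc 0 M.pbar) :
    M.pureRevenue φ N (μ S) p ≤ M.cappedRevenue N M.D p - (M.cappedRevenue N M.D p
      - M.cappedRevenue N (M.D - min M.D (M.mean S)) p) *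
        ((μ S).real (Iio p) + (μ S).real {p} / 2) := by
  have := hμ.1
  have hi : ∀ {s : Set ℝ} (c : ℝ), MeasurableSet s → Integrable (s.indicator fun _ => c) (μ S) :=
    fun c hs => (integrable_const c).indicator hs
  refine le_trans (integral_mono (M.integrable_payoff_right hD hμ hp)
    ((integrable_const _).sub ((hi _ measurableSet_Iio).add (hi _ (measurableSet_singleton p))))
    fun p' => M.payoff_noStorage_le hS hN hSN hNS hD hp.1 (hp.2.trans_lt M.pbar_lt_lam))
    (le_of_eq ?_)
  rw [integral_sub' (integrable_const _)
      ((hi _ measurableSet_Iio).add (hi _ (measurableSet_singleton p))),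
    integral_add' (hi _ measurableSet_Iio) (hi _ (measurableSet_singleton p)),
    integral_indicator_const _ measurableSet_Iio,
    integral_indicator_const _ (measurableSet_singleton p)]
  simp only [integral_const, probReal_univ, smul_eq_mul]
  ring

end PureRevenue

theorem sub_min_eq_max (S : Fin 2) : M.D - min M.D (M.mean S) = max (M.D - M.mean S) 0 := by
  rcases le_total M.D (M.mean S) with h | h
  · rw [min_eq_left h, sub_self, max_eq_right (by linarith)]
  · rw [min_eq_right h, max_eq_left (by linarith)]

/-- The threshold q = λ F_N(a) satisfies q < t ↔ a < y_N(t) for t < λ, so above it the order of sale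
affects both suppliers. -/
theorem undercuttingEquilibrium (hμ : M.IsMixedEquilibrium φ μ) (hS : φ S = true) (hN : φ N = false)
    (hSN : rival S = N) (hNS : rival N = S) (hD : 0 < M.D)
    (hD' : M.D < M.mean S + M.qty N false M.pbar) :
    UndercuttingEquilibrium M.pbar (min M.D (M.mean S))
      (M.lam * cdf (M.gen N) (M.D - min M.D (M.mean S)))
      (M.eqRevenue φ μ S) (M.eqRevenue φ μ N) (M.cappedRevenue N M.D)
      (M.cappedRevenue N (M.D - min M.D (M.mean S)))
      (M.pureRevenue φ S (μ N)) (M.pureRevenue φ N (μ S)) (μ S) (μ N) (M.lossMeasure S N μ) := by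
  have hprobN := (hμ.1 N).1
  have hlt : ∀ {p}, p ∈ Icc 0 M.pbar → p < M.lam := fun hp => hp.2.trans_lt M.pbar_lt_lam
  have hb : 0 < min M.D (M.mean S) := lt_min hD (M.mean_pos S)
  have ha : 0 ≤ M.D - min M.D (M.mean S) := sub_nonneg.2 (min_le_left _ _)
  have haD : M.D - min M.D (M.mean S) < M.D := by linarith
  have hq0 : 0 ≤ M.lam * cdf (M.gen N) (M.D - min M.D (M.mean S)) :=
    mul_nonneg M.lam_pos.le (cdf_nonneg _ _)
  -- This is where the upper bound on demand enters: it says that a < y_N(P).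
  have hqP : M.lam * cdf (M.gen N) (M.D - min M.D (M.mean S)) < M.pbar := by
    rw [← M.lt_qty_iff M.pbar_lt_lam ha, M.sub_min_eq_max]
    exact max_lt (by linarith) (M.qty_pos M.pbar_pos M.pbar_lt_lam)
  have hqty : ∀ {t}, t ∈ Ioc (M.lam * cdf (M.gen N) (M.D - min M.D (M.mean S))) M.pbar →
      M.D - min M.D (M.mean S) < M.qty N false t := fun ht =>
    (M.lt_qty_iff (ht.2.trans_lt M.pbar_lt_lam) ha).2 ht.1
  exact {
    probS := (hμ.1 S).1
    probN := (hμ.1 N).1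
    finite_loss := M.isFiniteMeasure_lossMeasure hD
    suppS := (hμ.1 S).2
    suppN := (hμ.1 N).2
    b_pos := hb
    q_nonneg := hq0
    q_lt := hqP
    G_cont := M.cappedRevenue_continuousOn hD.le
    H_cont := M.cappedRevenue_continuousOn ha
    G_strict := M.cappedRevenue_strictMonoOn hD
    G_zero := M.cappedRevenue_zero hD.le
    -- H vanishes identically exactly in the case a = 0, where `S` alone can serve the demand.
    H_alt := by
      rcases ha.eq_or_lt with h | h
      · refine Or.inr ⟨?_, fun t _ => ?_⟩
        · rw [← h, M.cdf_gen_zero, mul_zero]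
        · rw [← h, M.cappedRevenue_cap_zero]
      · exact Or.inl (M.cappedRevenue_strictMonoOn h)
    G_eq_H := by
      have hy := (M.qty_le_iff (i := N) (hqP.trans M.pbar_lt_lam) ha).2 le_rfl
      rw [cappedRevenue, cappedRevenue, min_eq_right hy, min_eq_right (hy.trans haD.le)]
    H_le_G := fun t ht => M.cappedRevenue_cap_mono haD.le ht.1 (hlt ht)
    H_lt_G := fun t ht => M.cappedRevenue_cap_lt ha haD (hq0.trans ht.1.le)
      (ht.2.trans_lt M.pbar_lt_lam) (hqty ht)
    loss_le := fun s => by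
      have h := ENNReal.toReal_mono (ENNReal.mul_ne_top ENNReal.ofReal_ne_top (measure_ne_top _ _))
        (M.lossMeasure_le (S := S) (N := N) (μ := μ) hD s)
      rwa [ENNReal.toReal_mul, ENNReal.toReal_ofReal hb.le] at h
    loss_zero := by
      rw [lossMeasure_singleton, M.clamp_eq ⟨le_rfl, M.pbar_pos.le⟩, lostSales, qty_zero,
        min_eq_right hD.le, min_eq_right ha]
      simp
    loss_atom := fun p hp hNp => by
      rw [lossMeasure_singleton, M.clamp_eq ⟨hq0.trans hp.1.le, hp.2⟩]
      refine mul_ne_zero ?_ hNp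
      simpa using M.lostSales_pos hD (hqty hp)
    US_lower := fun p hp => M.pureRevenue_storage_ge (hμ.1 N) hS hN hSN hD hp
    US_upper := fun p hp => M.pureRevenue_storage_le (hμ.1 N) hS hN hSN hD hp
    UN_lower := fun p hp => M.pureRevenue_noStorage_ge (hμ.1 S) hS hN hNS hD hp
    UN_upper := fun p hp => M.pureRevenue_noStorage_le (hμ.1 S) hS hN hSN hNS hD hp
    US_le := fun p hp => hSN ▸ hμ.pureRevenue_le hD hp
    UN_le := fun p hp => by
      have h := hμ.pureRevenue_le (i := N) hD hp
      rwa [hNS] at h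
    US_ae := hSN ▸ hμ.pureRevenue_ae hD
    UN_ae := by
      have h := hμ.pureRevenue_ae (i := N) hD
      rwa [hNS] at h }

end

end Market

end EnergyMarket

/-! ### The equilibrium price distributions -/

namespace EnergyMarket

namespace Market

variable (M : Market) {φ : Fin 2 → Bool} {S N : Fin 2} {μ : Fin 2 → Measure ℝ}

/-- The price distribution of the supplier with storage, from the indifference of his rival. -/
theorem cdf_storage_eq (hμ : M.IsMixedEquilibrium φ μ) (hS : φ S = true) (hN : φ N = false)
    (hSN : rival S = N) (hNS : rival N = S) (hD : 0 < M.D)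
    (hD' : M.D < M.mean S + M.qty N false M.pbar) {p : ℝ}
    (hp : p ∈ Ico (lowerSupport (μ N)) M.pbar) :
    0 < M.revenue N false p (min (M.qty N false p) M.D)
        - M.revenue N false p (max (M.D - M.mean S) 0) ∧
      cdf (μ S) p = (M.revenue N false p (min (M.qty N false p) M.D) - M.eqRevenue φ μ N) /
        (M.revenue N false p (min (M.qty N false p) M.D)
          - M.revenue N false p (max (M.D - M.mean S) 0)) := by
  have E := M.undercuttingEquilibrium hμ hS hN hSN hNS hD hD'
  have := E.probS
  have ha : 0 ≤ M.D - min M.D (M.mean S) := sub_nonneg.2 (min_le_left _ _)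
  have hq := E.lt_lowerSupportN.trans_le hp.1
  have hy := (M.lt_qty_iff (hp.2.trans M.pbar_lt_lam) ha).2 hq
  have hG : M.revenue N false p (min (M.qty N false p) M.D) = M.cappedRevenue N M.D p := by
    rw [min_comm, cappedRevenue]
  have hH : M.revenue N false p (max (M.D - M.mean S) 0) =
      M.cappedRevenue N (M.D - min M.D (M.mean S)) p := by
    rw [cappedRevenue, min_eq_left hy.le, M.sub_min_eq_max]
  have hpos := sub_pos.2 (E.H_lt_G p ⟨hq, hp.2.le⟩)
  have h := E.UN_eq_piN hp
  rw [E.UN_eq ⟨hq, hp.2⟩] at h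
  rw [hG, hH, cdf_eq_real, eq_div_iff hpos.ne']
  exact ⟨hpos, by linarith⟩

/-- The price distribution of the supplier without storage, from the indifference of his rival. -/
theorem cdf_noStorage_eq (hμ : M.IsMixedEquilibrium φ μ) (hS : φ S = true) (hN : φ N = false)
    (hSN : rival S = N) (hNS : rival N = S) (hD : 0 < M.D)
    (hD' : M.D < M.mean S + M.qty N false M.pbar) {p : ℝ}
    (hp : p ∈ Ico (lowerSupport (μ N)) M.pbar) :
    0 < p ^ 2 * min (M.qty N false p) M.D - p ^ 2 * max (M.D - M.mean S) 0 ∧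
      IntervalIntegrable (fun t : ℝ => M.eqRevenue φ μ S /
        (t ^ 2 * min (M.qty N false t) M.D - t ^ 2 * max (M.D - M.mean S) 0)) volume
        (lowerSupport (μ N)) p ∧
      cdf (μ N) p = ∫ t in lowerSupport (μ N)..p, M.eqRevenue φ μ S /
        (t ^ 2 * min (M.qty N false t) M.D - t ^ 2 * max (M.D - M.mean S) 0) := by
  have E := M.undercuttingEquilibrium hμ hS hN hSN hNS hD hD'
  have := E.probN
  have := E.finite_loss
  set l := lowerSupport (μ N)
  have ha : 0 ≤ M.D - min M.D (M.mean S) := sub_nonneg.2 (min_le_left _ _)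
  have hql := E.lt_lowerSupportN
  have hl0 : 0 < l := E.q_nonneg.trans_lt hql
  have hlm : l ∈ Ico l M.pbar := ⟨le_rfl, E.lowerSupport_lt⟩
  have hy : ∀ t ∈ Ico l M.pbar, M.D - min M.D (M.mean S) < M.qty N false t := fun t ht =>
    (M.lt_qty_iff (ht.2.trans M.pbar_lt_lam) ha).2 (hql.trans_le ht.1)
  have hden : ∀ t ∈ Ico l M.pbar, t ^ 2 * min (M.qty N false t) M.D
      - t ^ 2 * max (M.D - M.mean S) 0 = t ^ 2 * M.lostSales S N (M.clamp t) := fun t ht => by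
    rw [M.clamp_eq ⟨hl0.le.trans ht.1, ht.2.le⟩, lostSales, min_eq_left (hy t ht).le,
      M.sub_min_eq_max, min_comm]
    ring
  have hg : ∀ t ∈ Ico l M.pbar, 0 < M.lostSales S N (M.clamp t) := fun t ht => by
    rw [M.clamp_eq ⟨hl0.le.trans ht.1, ht.2.le⟩]
    exact M.lostSales_pos hD (hy t ht)
  -- The indifference of `S`, x(b − ν(−∞, x]) = π_S, solved for ν.
  have hloss : ∀ x ∈ Ico l M.pbar, (M.lossMeasure S N μ).real (Iic x) =
      min M.D (M.mean S) - M.eqRevenue φ μ S / x := fun x hx => by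
    have h := E.US_eq_piS hx
    rw [E.US_eq ⟨hql.trans_le hx.1, hx.2⟩] at h
    have hx0 : x ≠ 0 := (hl0.trans_le hx.1).ne'
    rw [← h]
    field_simp
    ring
  have hIoc : ∀ x ∈ Icc l p, M.lossMeasure S N μ (Ioc l x) =
      ENNReal.ofReal (∫ t in l..x, M.eqRevenue φ μ S / t ^ 2) := fun x hx => by
    rw [(integral_const_div_sq hl0 hx.1).2, ← ofReal_measureReal]
    congr 1
    have h := measureReal_union (μ := M.lossMeasure S N μ)
      (Iic_disjoint_Ioc (le_refl l) (c := x)) measurableSet_Ioc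
    rw [Iic_union_Ioc_eq_Iic hx.1, hloss l hlm, hloss x ⟨hx.1, hx.2.trans_lt hp.2⟩] at h
    linarith
  obtain ⟨hint, hmass⟩ := measureReal_Ioc_eq_integral_div (μ := μ N)
    (f := fun t => M.eqRevenue φ μ S / t ^ 2) (by fun_prop)
    (M.measurable_lostSales_clamp (S := S) (N := N)) hp.1
    (fun t _ => div_nonneg E.piS_pos.le (sq_nonneg t))
    (fun t ht => hg t ⟨ht.1.le, ht.2.trans_lt hp.2⟩) (integral_const_div_sq hl0 hp.1).1 hIoc
  have hcongr : EqOn (fun t => M.eqRevenue φ μ S / t ^ 2 / M.lostSales S N (M.clamp t))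
      (fun t => M.eqRevenue φ μ S /
        (t ^ 2 * min (M.qty N false t) M.D - t ^ 2 * max (M.D - M.mean S) 0)) (Icc l p) :=
    fun t ht => by
      simp only [hden t ⟨ht.1, ht.2.trans_lt hp.2⟩, div_div]
  have huIcc : uIcc l p = Icc l p := uIcc_of_le hp.1
  refine ⟨?_, ?_, ?_⟩
  · rw [hden p hp]
    exact mul_pos (pow_pos (hl0.trans_le hp.1) 2) (hg p hp)
  · refine hint.congr fun t ht => hcongr ?_
    rw [← huIcc]
    exact uIoc_subset_uIcc ht
  -- No mass of `N` lies at or below l: l is his lower support and not an atom, so the CDF at p is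
  -- the mass of (l, p].
  · rw [← intervalIntegral.integral_congr (huIcc.symm ▸ hcongr), ← hmass, cdf_eq_real,
      ← Iic_union_Ioc_eq_Iic hp.1, measureReal_union (Iic_disjoint_Ioc le_rfl) measurableSet_Ioc,
      measureReal_Iic_eq_add, measureReal_def (μ N) (Iio l), measureReal_def (μ N) {l},
      E.no_atomN ⟨hql, hlm.2⟩, measure_Iio_lowerSupport E.suppN]
    simp

end Market

theorem exists_storage_pair {φ : Fin 2 → Bool} (hφ : ∑ i, (φ i).toNat = 1) :
    ∃ S N : Fin 2, φ S = true ∧ φ N = false ∧ rival S = N ∧ rival N = S ∧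
      (Finset.univ : Finset (Fin 2)) = {S, N} ∧ S ≠ N := by
  rw [Fin.sum_univ_two] at hφ
  rcases h0 : φ 0 <;> rcases h1 : φ 1 <;> simp [h0, h1] at hφ
  · exact ⟨1, 0, h1, h0, by decide, by decide, by decide, by decide⟩
  · exact ⟨0, 1, h0, h1, by decide, by decide, by decide, by decide⟩

end EnergyMarket

theorem theorem2 (M : EnergyMarket.Market) (φ : Fin 2 → Bool)
    (hφ : ∑ i, (φ i).toNat = 1)
    (hD : 0 < M.D) (hD' : M.D < ∑ i, M.qty i (φ i) M.pbar)
    (μ : Fin 2 → Measure ℝ) (hμ : M.IsMixedEquilibrium φ μ) :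
    ∃ l : ℝ, 0 < l ∧ l < M.pbar ∧ (∀ i, EnergyMarket.lowerSupport (μ i) = l) ∧
      ∀ i j : Fin 2, j = EnergyMarket.rival i →
        (φ i = true → ∀ p : ℝ, l ≤ p → p < M.pbar →
          0 < M.revenue j (φ j) p (min (M.qty j (φ j) p) M.D)
              - M.revenue j (φ j) p (max (M.D - M.mean i) 0) ∧
          cdf (μ i) p =
            (M.revenue j (φ j) p (min (M.qty j (φ j) p) M.D) - M.eqRevenue φ μ j) /
              (M.revenue j (φ j) p (min (M.qty j (φ j) p) M.D)
                - M.revenue j (φ j) p (max (M.D - M.mean i) 0))) ∧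
        (φ i = false → ∀ p : ℝ, l ≤ p → p < M.pbar →
          0 < p ^ 2 * min (M.qty i (φ i) p) M.D - p ^ 2 * max (M.D - M.mean j) 0 ∧
          IntervalIntegrable (fun t : ℝ => M.eqRevenue φ μ j /
              (t ^ 2 * min (M.qty i (φ i) t) M.D - t ^ 2 * max (M.D - M.mean j) 0)) volume l p ∧
          cdf (μ i) p =
            ∫ t in l..p, M.eqRevenue φ μ j /
              (t ^ 2 * min (M.qty i (φ i) t) M.D - t ^ 2 * max (M.D - M.mean j) 0)) := by
  obtain ⟨S, N, hS, hN, hSN, hNS, huniv, hne⟩ := EnergyMarket.exists_storage_pair hφ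
  have hcases : ∀ i : Fin 2, i = S ∨ i = N := fun i => by
    simpa [huniv] using Finset.mem_univ i
  have hD'' : M.D < M.mean S + M.qty N false M.pbar := by
    rw [huniv, Finset.sum_pair hne, hS, hN] at hD'
    simpa [EnergyMarket.Market.qty] using hD'
  have E := M.undercuttingEquilibrium hμ hS hN hSN hNS hD hD''
  refine ⟨EnergyMarket.lowerSupport (μ N), E.q_nonneg.trans_lt E.lt_lowerSupportN,
    E.lowerSupport_lt, fun i => ?_, fun i j hj => ?_⟩
  · rcases hcases i with rfl | rfl
    · exact E.lowerSupport_eq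
    · rfl
  · rcases hcases i with hi | hi
    · obtain rfl : j = N := by rw [hj, hi, hSN]
      subst hi
      refine ⟨fun _ p hlp hp => ?_, fun h => by simp [hS] at h⟩
      rw [hN]
      exact M.cdf_storage_eq hμ hS hN hSN hNS hD hD'' ⟨hlp, hp⟩
    · obtain rfl : j = S := by rw [hj, hi, hNS]
      subst hi
      refine ⟨fun h => by simp [hN] at h, fun _ p hlp hp => ?_⟩
      rw [hN]
      exact M.cdf_noStorage_eq hμ hS hN hSN hNS hD hD'' ⟨hlp, hp⟩
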